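/- **Setting.** Use coordinates $(\nu_1,\nu_2,\nu_3)$ on $\mathbb R^3$ in which the light cone is $2\nu_1\nu_3=\nu_2^2$. For $K\ge 10$ let $$\Gamma_{1/K}=\{\,2\nu_1\nu_3=\nu_2^2,\ 1-\tfrac1K\le \nu_3\le 1,\ |\nu_2/\nu_3|\le 1\,\},$$ and let $N_{\varepsilon}(\Gamma_{1/K})$ be its closed $\varepsilon$-neighbourhood. *Sectors and boxes.* For $|\eta|\le 1$ put $\mathbf c(\eta)=(\eta^2/2,\eta,1)$, $\mathbf n(\eta)=(1,-\eta,\eta^2/2)$, $\mathbf t(\eta)=(\eta,1-\eta^2/2,-\eta)$. For $0<s\le 1$ the sector with direction $\eta$ and aperture $d(\tau)=s$ is the box $$\tau(s,\eta)=\{\omega: |\omega_3-1|\le \tfrac1K+s^2,\ |\omega_2-\eta\omega_3|\le 3s,\ |\mathbf n(\eta)\cdot\omega|\le 2s^2\},$$ which is comparable to the $s^2$-neighbourhood of $\{\nu\in\Gamma_{1/K}:|\nu_2/\nu_3-\eta|\le s\}$. Let $\mathbf S_s$ be the set of the $\lceil 1/s\rceil$ sectors $\tau(s,\eta)$ with $\eta$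 evenly spaced from $-1+s$ to $1-s$ (only $\eta=0$ if $s=1$). For $\tau=\tau(s,\eta)$ and $\rho>0$ let $$U_{\tau,\rho}=\{x: |\mathbf c(\eta)\cdot x|\le\rho s^2,\ |\mathbf n(\eta)\cdot x|\le \rho,\ |\mathbf t(\eta)\cdot x|\le\rho s\}.$$ *Decompositions.* Let $R\ge 1$ and let $f$ be a smooth function of temperate growth on $\mathbb R^3$ whose (distributional) Fourier transform is supported in $N_{1/R}(\Gamma_{1/K})$. Write $f=\sum_{\theta\in\mathbf S_{R^{-1/2}}}f_\theta$ with smooth $f_\theta$ of temperate growth and $\hat f_\theta$ supported in $\theta$. For every $s\in[R^{-1/2},1]$ assign to each $\theta\in \mathbf S_{R^{-1/2}}$ one sector $\tau\in\mathbf S_s$ that intersects $\theta$; "$\theta\subset\tau$" means that $\theta$ is assigned to $\tau$, and $f_\tau=\sum_{\theta\subset\tau}f_\theta$. For $1\le r\le R$ and a ball $B_r$ of radius $r$, and for a translate $U$ of $U_{\tau,R}$, put $$S_{B_r}f=\Big(\sum_{\tau\in\mathbf S_{r^{-1/2}}}|f_\tau|^2\Big)^{1/2}\Big|_{B_r},\qquad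 S_Uf=\Big(\sum_{\theta\subset\tau}|f_\theta|^2\Big)^{1/2}\Big|_U .$$ *The constant.* Fix $M\in\mathbb N$. Let $S_K(r,R)\in[0,\infty]$ be the smallest constant such that $$\sum_{B_r}|B_r|^{-1}\|S_{B_r}f\|_{L^2(B_r)}^4\ \le\ S_K(r,R)\sum_{\substack{R^{-1/2}\le s\le1\\ s\ \mathrm{dyadic}}}\ \sum_{\tau\in\mathbf S_s}\ \sum_{U\parallel U_{\tau,R}}|U|^{-1}\|S_Uf\|_{L^2}^4$$ for all such $f$, all decompositions $\{f_\theta\}$, all such assignments, all covers of $\mathbb R^3$ by balls $B_r$ of radius $r$ with overlap at most $M$, and all tilings of $\mathbb R^3$ by translates $U$ of $U_{\tau,R}$ (one tiling for each $\tau$). **Lemma.** For every $M\in\mathbb N$ and every $\delta>0$ there is a constant $C_{\delta}$, depending only on $\delta$ and $M$, such that for all $K\ge 10$ and all $1\le r\le K$, $$S_K(r,K)\le C_{\delta}K^{\delta}.$$ -/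

import Mathlib

open MeasureTheory
open scoped ENNReal FourierTransform SchwartzMap Pointwise

namespace ConeSquareFunction

noncomputable section

/-- Three-dimensional Euclidean space, both on the physical and on the frequency side.  All
coordinates are the rotated coordinates `(ν₁, ν₂, ν₃) = (x 0, x 1, x 2)`, in which the light cone is
`2 ν₁ ν₃ = ν₂ ^ 2`. -/
abbrev E3 : Type := EuclideanSpace ℝ (Fin 3)

/-- The truncated cone `Γ_{1/K}` of height `1 / K`. -/
def shortCone (K : ℝ) : Set E3 :=
  {v | 2 * v 0 * v 2 = v 1 ^ 2 ∧ 1 - 1 / K ≤ v 2 ∧ v 2 ≤ 1 ∧ |v 1 / v 2| ≤ 1}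

/-- The closed neighbourhood `N_ε(Γ_{1/K})`. -/
def coneNhd (K ε : ℝ) : Set E3 := Metric.cthickening ε (shortCone K)

/-! ### Sectors -/

/-- Core line direction of the cone over the parabola point with parameter `η = ν₂ / ν₃`.  The
vectors `core η`, `normal η`, `tangent η` are orthogonal and all have length
`1 + η ^ 2 / 2 ∈ [1, 3 / 2]`. -/
def core (η : ℝ) : E3 := !₂[η ^ 2 / 2, η, 1]

/-- Normal direction of the cone along the line spanned by `core η`. -/
def normal (η : ℝ) : E3 := !₂[1, -η, η ^ 2 / 2]

/-- Tangent direction of the cone, orthogonal to `core η`. -/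
def tangent (η : ℝ) : E3 := !₂[η, 1 - η ^ 2 / 2, -η]

/-- The directions `η` of the sectors of aperture `s` (for `0 < s ≤ 1`): `⌈1 / s⌉` evenly spaced
points, the first being `-1 + s` and the last `1 - s` (only the point `0` if `s = 1`).  The
intervals `[η - s, η + s]` are contained in `[-1, 1]` and cover it with bounded overlap. -/
def directions (s : ℝ) : Finset ℝ :=
  (Finset.range ⌈s⁻¹⌉₊).image fun i : ℕ => (1 - s) * (2 * (i : ℝ) / ((⌈s⁻¹⌉₊ : ℝ) - 1) - 1)

/-- The sector `τ` with direction `η` and aperture `s`.  It is a convex box with centre on the core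
line that contains the `s ^ 2`-neighbourhood of the surface sector
`{ν ∈ Γ_{1/K} : |ν₂ / ν₃ - η| ≤ s}` and is comparable to it up to absolute constants (for
`s ^ 2 ≤ 1 / K` it is also comparable to the convex hull of the surface sector).  The two linear
forms are those of the Lorentz rescaling that maps the surface sector onto `Γ_{1/K}`; the last one
is the inner product of `ω` with `normal η`. -/
def sector (K s η : ℝ) : Set E3 :=
  {ω | |ω 2 - 1| ≤ 1 / K + s ^ 2 ∧ |ω 1 - η * ω 2| ≤ 3 * s ∧
    |ω 0 - η * ω 1 + η ^ 2 / 2 * ω 2| ≤ 2 * s ^ 2}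

/-- The box `U_{τ,ρ}` for the sector `τ` with direction `η` and aperture `s`; its dimensions are
about `ρ s ^ 2 × ρ s × ρ`. -/
def box (ρ s η : ℝ) : Set E3 :=
  {x | |inner ℝ (core η) x| ≤ ρ * s ^ 2 ∧ |inner ℝ (normal η) x| ≤ ρ ∧
    |inner ℝ (tangent η) x| ≤ ρ * s}

/-! ### Tilings and coverings -/

/-- The translates of `U` by the vectors in `V` tile `ℝ³` (up to null sets). -/
structure IsTiling (U V : Set E3) : Prop where
  cover : ∀ x : E3, ∃ v ∈ V, x ∈ v +ᵥ U
  disjoint : V.Pairwise fun v w => AEDisjoint volume (v +ᵥ U) (w +ᵥ U)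

/-- The balls of radius `r` with centres in `V` cover `ℝ³`, and no point is in more than `M` of
them. -/
structure IsBallCover (M : ℕ) (r : ℝ) (V : Set E3) : Prop where
  cover : ∀ x : E3, ∃ v ∈ V, x ∈ Metric.closedBall v r
  overlap : ∀ x : E3, {v ∈ V | x ∈ Metric.closedBall v r}.encard ≤ M

/-! ### Functions and their decompositions -/

/-- `supp f̂ ⊆ S` for a closed set `S`: the Fourier transform of `f`, taken in the sense of tempered
distributions, vanishes on the complement of `S`.  (A tempered distribution whose Fourier transform
has compact support is a smooth function of temperate growth.) -/
def FourierSupportedIn (f : E3 → ℂ) (S : Set E3) : Prop :=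
  ∃ hf : f.HasTemperateGrowth,
    Distribution.IsVanishingOn
      (𝓕 (hf.toTemperedDistribution (volume : Measure E3)) : 𝓢'(E3, ℂ)) Sᶜ

/-- `f` has Fourier support in `N_{1/R}(Γ_{1/K})`, and `f = ∑_θ f_θ` where `θ` runs over the sectors
of aperture `R ^ (-1/2)` and `f_θ` has Fourier support in `θ`.  For the sector `θ` with direction
`η` the function `f_θ` is `F η`. -/
structure IsDecomposition (K R : ℝ) (f : E3 → ℂ) (F : ℝ → E3 → ℂ) : Prop where
  support : FourierSupportedIn f (coneNhd K R⁻¹)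
  support_piece : ∀ η ∈ directions (√R)⁻¹, FourierSupportedIn (F η) (sector K (√R)⁻¹ η)
  sum_eq : ∀ x, f x = ∑ η ∈ directions (√R)⁻¹, F η x

/-- For every aperture `s ∈ [R ^ (-1/2), 1]`, the map `A s` assigns to each sector `θ` of aperture
`R ^ (-1/2)` one sector `τ` of aperture `s` that intersects `θ`.  (Sectors of a given aperture are
represented by their directions.)  The relation "`θ ⊂ τ`" means that `τ` is assigned to `θ`. -/
def IsAssignment (K R : ℝ) (A : ℝ → ℝ → ℝ) : Prop :=
  ∀ s, (√R)⁻¹ ≤ s → s ≤ 1 → ∀ η ∈ directions (√R)⁻¹,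
    A s η ∈ directions s ∧ (sector K (√R)⁻¹ η ∩ sector K s (A s η)).Nonempty

/-- The (directions of the) sectors `θ` of aperture `R ^ (-1/2)` with `θ ⊂ τ`, where `τ` is the
sector with aperture `s` and direction `ζ`. -/
def children (R : ℝ) (A : ℝ → ℝ → ℝ) (s ζ : ℝ) : Finset ℝ :=
  {η ∈ directions (√R)⁻¹ | A s η = ζ}

/-- `f_τ = ∑_{θ ⊂ τ} f_θ` for the sector `τ` with aperture `s` and direction `ζ`. -/
def sectorPiece (R : ℝ) (A : ℝ → ℝ → ℝ) (F : ℝ → E3 → ℂ) (s ζ : ℝ) (x : E3) : ℂ :=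
  ∑ η ∈ children R A s ζ, F η x

/-! ### The two sides of the inequality and the best constant -/

/-- `∑_{B_r} |B_r|⁻¹ ‖S_{B_r} f‖_{L²(B_r)}⁴`, with `|S_{B_r} f|² = ∑_{d(τ) = r^(-1/2)} |f_τ|²`; the
balls `B_r` are those with centres in `V`. -/
def ballSum (r R : ℝ) (A : ℝ → ℝ → ℝ) (F : ℝ → E3 → ℂ) (V : Set E3) : ℝ≥0∞ :=
  ∑' v : V, (volume (Metric.closedBall (v : E3) r))⁻¹ *
    (∫⁻ x in Metric.closedBall (v : E3) r,
      ∑ ζ ∈ directions (√r)⁻¹, ‖sectorPiece R A F (√r)⁻¹ ζ x‖ₑ ^ 2) ^ 2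

/-- `∑_{R^(-1/2) ≤ s ≤ 1} ∑_{d(τ) = s} ∑_{U ∥ U_{τ,R}} |U|⁻¹ ‖S_U f‖_{L²}⁴`, with
`|S_U f|² = ∑_{θ ⊂ τ} |f_θ|²` on `U`; the first sum is over the dyadic numbers `s = 2 ^ (-k)`, and
the sets `U` are the translates of `U_{τ,R}` by the vectors in `T s ζ`. -/
def boxSum (R : ℝ) (A : ℝ → ℝ → ℝ) (F : ℝ → E3 → ℂ) (T : ℝ → ℝ → Set E3) : ℝ≥0∞ :=
  ∑' k : {k : ℕ // (√R)⁻¹ ≤ (2⁻¹ : ℝ) ^ k}, ∑ ζ ∈ directions ((2⁻¹ : ℝ) ^ (k : ℕ)),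
    ∑' v : T ((2⁻¹ : ℝ) ^ (k : ℕ)) ζ,
      (volume ((v : E3) +ᵥ box R ((2⁻¹ : ℝ) ^ (k : ℕ)) ζ))⁻¹ *
        (∫⁻ x in (v : E3) +ᵥ box R ((2⁻¹ : ℝ) ^ (k : ℕ)) ζ,
          ∑ η ∈ children R A ((2⁻¹ : ℝ) ^ (k : ℕ)) ζ, ‖F η x‖ₑ ^ 2) ^ 2

/-- `C` is admissible for `(K, r, R)` if the inequality between the two sums holds with constant
`C`, for all `f` with Fourier support in `N_{1/R}(Γ_{1/K})`, all decompositions of `f`, all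
assignments of sectors, all coverings of `ℝ³` by balls of radius `r` with overlap at most `M`, and
all tilings of `ℝ³` by translates of the boxes `U_{τ,R}`. -/
def IsAdmissibleConstant (M : ℕ) (K r R : ℝ) (C : ℝ≥0∞) : Prop :=
  ∀ (f : E3 → ℂ) (F : ℝ → E3 → ℂ) (A : ℝ → ℝ → ℝ) (V : Set E3) (T : ℝ → ℝ → Set E3),
    IsDecomposition K R f F → IsAssignment K R A → IsBallCover M r V →
    (∀ s, (√R)⁻¹ ≤ s → s ≤ 1 → ∀ ζ ∈ directions s, IsTiling (box R s ζ) (T s ζ)) →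
    ballSum r R A F V ≤ C * boxSum R A F T

/-- `S_K(r, R)`, the smallest admissible constant (`∞` if there is no finite one). -/
def SK (M : ℕ) (K r R : ℝ) : ℝ≥0∞ := sInf {C | IsAdmissibleConstant M K r R C}

end

end ConeSquareFunction

namespace ConeSquareFunction

/-! ### Schwartz functions and their Fourier supports -/

/-! Put `s = K ^ (-1/2)`. Since `R = K`, the piece of cone has height `s ^ 2`, so up to errors `O(s
^ 2)` it is the planar parabola `2 ν₁ = ν₂ ^ 2` at height `ν₃ = 1`, and each `θ` is a neighbourhood
of an arc of length about `s`. Planar arguments therefore apply, and they give a constant depending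
only on `M`.

Cauchy–Schwarz on each ball bounds the left side by `M ∫ (∑_τ |f_τ|²)²` (`IsBallCover.tsum_le`). Two
estimates remain.

Square function (Córdoba–Fefferman): a point of `θ + θ'` determines the pair `(θ, θ')` up to
boundedly many choices (`card_pairs_le`). Plancherel then bounds `∫ (∑_τ |f_τ|²)²` by a multiple of
`∫ (∑_θ |f_θ|²)²` (`lintegral_sq_sum_groups_le`).

Kakeya type (`lintegral_sq_sum_le_boxSum`): `|f_θ|²` has frequencies in `θ - θ`, a tube through the
origin of length about `s` and width about `s ^ 2`. Tubes through a common `ω` with `|ω₂| ~ s ^ 2 /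
σ` have directions within `O(σ)` of each other (`abs_sub_le_of_mem_diffBox`), so boundedly many `τ`
of aperture `σ` contribute there. On that slab the frequencies of `∑_{θ ⊂ τ} |f_θ|²` lie in a
multiple of the dual of `U_{τ,K}` (`abs_inner_le_of_mem_box`), so its `L²` mass is controlled by
averages over a tiling by `U_{τ,K}` (`setLIntegral_fourier_le`). Each dyadic slab is charged to its
own term of the right side, so not even a logarithm is lost.

Both estimates are proved for Schwartz functions; cutoffs with small Fourier support and Fatou's
lemma give the general case. -/

theorem lintegral_enorm_sq_fourier (f : 𝓢(E3, ℂ)) :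
    ∫⁻ ξ, ‖𝓕 f ξ‖ₑ ^ 2 = ∫⁻ x, ‖f x‖ₑ ^ 2 := by
  have key : ∀ g : 𝓢(E3, ℂ), ∫⁻ x, ‖g x‖ₑ ^ 2 = ENNReal.ofReal (∫ x, ‖g x‖ ^ 2) := by
    intro g
    have hg : Integrable (fun x => ‖g x‖ ^ 2) (volume : Measure E3) :=
      (g.memLp 2 volume).integrable_norm_pow (by norm_num)
    rw [ofReal_integral_eq_lintegral_ofReal hg (Filter.Eventually.of_forall fun x => by positivity)]
    refine lintegral_congr fun x => ?_
    rw [ENNReal.ofReal_pow (norm_nonneg _), ofReal_norm]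
  rw [key, key, SchwartzMap.integral_norm_sq_fourier]

theorem enorm_sum_sq_le {ι : Type*} (s : Finset ι) (a : ι → ℂ) :
    ‖∑ i ∈ s, a i‖ₑ ^ 2 ≤ {i ∈ s | a i ≠ 0}.card * ∑ i ∈ s, ‖a i‖ₑ ^ 2 := by
  have h1 : ∑ i ∈ s, a i = ∑ i ∈ s with a i ≠ 0, a i := (Finset.sum_filter_ne_zero s).symm
  have h2 : ‖∑ i ∈ s with a i ≠ 0, a i‖ ^ 2 ≤
      {i ∈ s | a i ≠ 0}.card * ∑ i ∈ s with a i ≠ 0, ‖a i‖ ^ 2 := by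
    refine (pow_le_pow_left₀ (norm_nonneg _) (norm_sum_le _ _) 2).trans ?_
    exact sq_sum_le_card_mul_sum_sq
  have h3 := ENNReal.ofReal_le_ofReal h2
  rw [ENNReal.ofReal_mul (by positivity), ENNReal.ofReal_sum_of_nonneg (fun _ _ => by positivity),
    ENNReal.ofReal_pow (norm_nonneg _), ofReal_norm, ENNReal.ofReal_natCast] at h3
  rw [h1]
  refine h3.trans ?_
  gcongr
  refine (Finset.sum_le_sum fun i _ => ?_).trans
    (Finset.sum_le_sum_of_subset (Finset.filter_subset _ s))
  rw [ENNReal.ofReal_pow (norm_nonneg _), ofReal_norm]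

theorem fourier_sum_apply {ι : Type*} (s : Finset ι) (h : ι → 𝓢(E3, ℂ)) (ξ : E3) :
    𝓕 (∑ i ∈ s, h i) ξ = ∑ i ∈ s, 𝓕 (h i) ξ := by
  have : 𝓕 (∑ i ∈ s, h i) = ∑ i ∈ s, 𝓕 (h i) :=
    map_sum (FourierTransform.fourierCLM ℂ 𝓢(E3, ℂ)) h s
  rw [this]; simp

/-- Almost orthogonality: Plancherel, with pointwise Cauchy–Schwarz over only those terms that are
nonzero at the given frequency. -/
theorem lintegral_enorm_sum_sq_le {ι : Type*} (s : Finset ι) (h : ι → 𝓢(E3, ℂ)) (N : ℕ)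
    (hN : ∀ ξ, {i ∈ s | 𝓕 (h i) ξ ≠ 0}.card ≤ N) :
    ∫⁻ x, ‖∑ i ∈ s, h i x‖ₑ ^ 2 ≤ N * ∑ i ∈ s, ∫⁻ x, ‖h i x‖ₑ ^ 2 := by
  have h1 : ∀ x, ∑ i ∈ s, h i x = (∑ i ∈ s, h i) x := by simp
  simp_rw [h1]
  rw [← lintegral_enorm_sq_fourier]
  simp_rw [fourier_sum_apply]
  calc ∫⁻ ξ, ‖∑ i ∈ s, 𝓕 (h i) ξ‖ₑ ^ 2
      ≤ ∫⁻ ξ, N * ∑ i ∈ s, ‖𝓕 (h i) ξ‖ₑ ^ 2 := by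
        refine lintegral_mono fun ξ => (enorm_sum_sq_le s _).trans ?_
        gcongr
        exact hN ξ
    _ = N * ∑ i ∈ s, ∫⁻ x, ‖h i x‖ₑ ^ 2 := by
        rw [lintegral_const_mul' _ _ (by simp), lintegral_finsetSum]
        · simp_rw [lintegral_enorm_sq_fourier]
        · intro i _
          exact (𝓕 (h i)).continuous.enorm.measurable.pow_const 2

/-- Pointwise product of Schwartz functions. -/
noncomputable def schwartzMul (f g : 𝓢(E3, ℂ)) : 𝓢(E3, ℂ) :=
  SchwartzMap.pairing (ContinuousLinearMap.mul ℂ ℂ) f g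

@[simp] theorem schwartzMul_apply (f g : 𝓢(E3, ℂ)) (x : E3) : schwartzMul f g x = f x * g x := rfl

/-- Pointwise complex conjugate of a Schwartz function. -/
noncomputable def schwartzConj (f : 𝓢(E3, ℂ)) : 𝓢(E3, ℂ) :=
  f.postcompCLM (Complex.conjCLE : ℂ →L[ℝ] ℂ)

@[simp] theorem schwartzConj_apply (f : 𝓢(E3, ℂ)) (x : E3) :
    schwartzConj f x = (starRingEnd ℂ) (f x) := rfl

theorem fourierInv_eq_fourier_neg (f : 𝓢(E3, ℂ)) (ξ : E3) : 𝓕⁻ f ξ = 𝓕 f (-ξ) := by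
  rw [SchwartzMap.fourierInv_coe, SchwartzMap.fourier_coe, Real.fourierInv_eq_fourier_neg]

theorem exists_of_fourier_schwartzMul_ne_zero {f g : 𝓢(E3, ℂ)} {ξ : E3}
    (h : 𝓕 (schwartzMul f g) ξ ≠ 0) : ∃ α β, 𝓕 f α ≠ 0 ∧ 𝓕 g β ≠ 0 ∧ α + β = ξ := by
  by_contra! hc
  apply h
  have h1 : 𝓕⁻ (schwartzMul f g) =
      SchwartzMap.convolution (ContinuousLinearMap.mul ℂ ℂ) (𝓕⁻ f) (𝓕⁻ g) := by
    simp [SchwartzMap.convolution, schwartzMul]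
  have h2 : 𝓕 (schwartzMul f g) ξ = 𝓕⁻ (schwartzMul f g) (-ξ) := by
    rw [fourierInv_eq_fourier_neg, neg_neg]
  rw [h2, h1, SchwartzMap.convolution_apply, convolution]
  refine integral_eq_zero_of_ae (Filter.Eventually.of_forall fun t => ?_)
  simp only [fourierInv_eq_fourier_neg, ContinuousLinearMap.mul_apply', Pi.zero_apply, mul_eq_zero]
  by_contra! h3
  exact hc _ _ h3.1 h3.2 (by abel)

theorem fourier_schwartzConj (f : 𝓢(E3, ℂ)) (ξ : E3) :
    𝓕 (schwartzConj f) ξ = (starRingEnd ℂ) (𝓕 f (-ξ)) := by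
  simp only [SchwartzMap.fourier_coe, Real.fourier_eq]
  rw [← integral_conj]
  congr with x
  simp [Circle.smul_def, ← Circle.coe_inv_eq_conj, AddChar.map_neg_eq_inv]

/-! ### Cutoffs and small phases -/

/-- A function with compactly supported Fourier transform becomes a Schwartz function after
multiplication by a Schwartz function, and the Fourier support is fattened accordingly. -/
theorem FourierSupportedIn.exists_schwartz_mul {f : E3 → ℂ} {S : Set E3}
    (h : FourierSupportedIn f S) {ε : ℝ} (χ : 𝓢(E3, ℂ)) (hχ : ∀ ξ, ε < ‖ξ‖ → 𝓕 χ ξ = 0) :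
    ∃ g : 𝓢(E3, ℂ), (∀ x, g x = f x * χ x) ∧ ∀ ξ, 𝓕 g ξ ≠ 0 → ∃ ζ ∈ S, ‖ξ - ζ‖ ≤ ε := by
  obtain ⟨hf, hv⟩ := h
  refine ⟨SchwartzMap.smulLeftCLM ℂ f χ, fun x => by
    rw [SchwartzMap.smulLeftCLM_apply_apply hf, smul_eq_mul], fun ξ hξ => ?_⟩
  by_contra! hc
  apply hξ
  -- Since `𝓕 ψ x = e(-x·ξ) χ x`, pairing `𝓕 f` with `ψ` gives the Fourier transform of `f χ` at
  -- `ξ`. The support of `ψ` lies in the closed `ε`-ball about `ξ`, which misses `S`.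
  let ψ : 𝓢(E3, ℂ) := SchwartzMap.compCLMOfAntilipschitz ℂ (K := 1) (g := fun x => ξ - x)
    (by fun_prop) (fun _ _ => by simp [edist_dist, dist_eq_norm, norm_sub_rev]) (𝓕 χ)
  have hψ : ∀ x, ψ x = 𝓕 χ (ξ - x) := fun x => rfl
  have hF : ∀ x, 𝓕 ψ x = Real.fourierChar (-inner ℝ x ξ) • χ x := by
    intro x
    have h1 : χ x = 𝓕⁻ (𝓕 χ) x := by simp
    rw [h1, SchwartzMap.fourier_coe ψ, Real.fourier_eq, SchwartzMap.fourierInv_coe,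
      Real.fourierInv_eq, ← integral_sub_left_eq_self _ volume ξ]
    simp only [Circle.smul_def, ← integral_smul]
    congr with v
    simp only [hψ, sub_sub_cancel, ← Circle.smul_def, smul_smul, ← AddChar.map_add_eq_mul]
    congr 2
    rw [inner_sub_left, real_inner_comm ξ x]
    ring
  have hts : tsupport ψ ⊆ Sᶜ := by
    intro v hv hvS
    have hcl : tsupport ψ ⊆ {v | ‖ξ - v‖ ≤ ε} := by
      refine closure_minimal ?_ (isClosed_le (by fun_prop) continuous_const)
      intro w hw
      by_contra hcon
      exact hw (by rw [hψ]; exact hχ _ (not_le.1 hcon))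
    exact absurd (hcl hv) (not_le.2 (hc v hvS))
  have h0 := hv ψ hts
  replace h0 : ∫ x, 𝓕 ψ x • f x = 0 := h0
  rw [SchwartzMap.fourier_coe, Real.fourier_eq, ← h0]
  congr with v
  rw [hF, SchwartzMap.smulLeftCLM_apply_apply hf]
  simp only [Circle.smul_def, smul_eq_mul]
  ring

theorem norm_fourierChar_sub_one_le (t : ℝ) :
    ‖(Real.fourierChar t : ℂ) - 1‖ ≤ 2 * Real.pi * |t| := by
  rw [Real.fourierChar_apply, mul_comm _ Complex.I]
  refine (Real.norm_exp_I_mul_ofReal_sub_one_le).trans ?_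
  rw [Real.norm_eq_abs, abs_mul, abs_of_pos Real.two_pi_pos]

/-- A nonnegative integrable function concentrated where the phase is small has a large Fourier
integral. -/
theorem norm_fourier_sub_integral_le {φ : E3 → ℝ} (hφ : Integrable φ) (h0 : ∀ x, 0 ≤ φ x)
    {ω : E3} {c : ℝ} (hc : ∀ x, φ x ≠ 0 → |inner ℝ x ω| ≤ c) :
    ‖𝓕 (fun x => (φ x : ℂ)) ω - ((∫ x, φ x : ℝ) : ℂ)‖ ≤ 2 * Real.pi * c * ∫ x, φ x := by
  have hi : Integrable (fun x => (φ x : ℂ)) := hφ.ofReal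
  have hi2 : Integrable (fun x => Real.fourierChar (-inner ℝ x ω) • (φ x : ℂ)) := by
    simpa using (Real.fourierIntegral_convergent_iff ω).2 hi
  rw [Real.fourier_eq, ← integral_complex_ofReal, ← integral_sub hi2 hi, ← integral_const_mul]
  refine norm_integral_le_of_norm_le (hφ.const_mul _) (Filter.Eventually.of_forall fun x => ?_)
  have : Real.fourierChar (-inner ℝ x ω) • (φ x : ℂ) - (φ x : ℂ) =
      ((Real.fourierChar (-inner ℝ x ω) : ℂ) - 1) * φ x := by
    rw [Circle.smul_def, smul_eq_mul]; ring
  rw [this, norm_mul, Complex.norm_real, Real.norm_eq_abs, abs_of_nonneg (h0 x)]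
  by_cases hx : φ x = 0
  · simp [hx]
  · have := norm_fourierChar_sub_one_le (-inner ℝ x ω)
    rw [abs_neg] at this
    refine mul_le_mul_of_nonneg_right (this.trans ?_) (h0 x)
    exact mul_le_mul_of_nonneg_left (hc x hx) Real.two_pi_pos.le

/-- `χ` is the Fourier transform of a bump of mass one supported in the `ε`-ball: positivity and
mass one give `‖χ‖ ≤ 1`, and small phases give `χ` close to `1` where `ε ‖x‖` is small. -/
theorem exists_schwartz_cutoff {ε : ℝ} (hε : 0 < ε) :
    ∃ χ : 𝓢(E3, ℂ), (∀ x, ‖χ x‖ ≤ 1) ∧ (∀ ξ, ε < ‖ξ‖ → 𝓕 χ ξ = 0) ∧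
      ∀ x, ‖χ x - 1‖ ≤ 2 * Real.pi * (ε * ‖x‖) := by
  let b : ContDiffBump (0 : E3) := ⟨ε / 2, ε, by positivity, by linarith⟩
  let φ : E3 → ℝ := b.normed volume
  have hφc : HasCompactSupport (fun x => (φ x : ℂ)) :=
    (b.hasCompactSupport_normed (μ := volume)).comp_left Complex.ofReal_zero
  let B : 𝓢(E3, ℂ) := hφc.toSchwartzMap
    (Complex.ofRealCLM.contDiff.comp (b.contDiff_normed (μ := volume)))
  have hB : (B : E3 → ℂ) = fun x => (φ x : ℂ) := rfl
  have hφi : Integrable φ := b.integrable_normed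
  have hφ1 : ∫ x, φ x = 1 := b.integral_normed
  have hφ0 : ∀ x, 0 ≤ φ x := fun x => b.nonneg_normed x
  have hsup : ∀ x, φ x ≠ 0 → ‖x‖ ≤ ε := by
    intro x hx
    have : x ∈ Function.support (b.normed volume) := hx
    rw [b.support_normed_eq] at this
    simpa using (Metric.mem_ball.1 this).le
  refine ⟨𝓕 B, fun x => ?_, fun ξ hξ => ?_, fun x => ?_⟩
  · rw [SchwartzMap.fourier_coe, Real.fourier_eq, ← hφ1]
    refine norm_integral_le_of_norm_le hφi (Filter.Eventually.of_forall fun v => ?_)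
    rw [Circle.norm_smul, hB, Complex.norm_real, Real.norm_eq_abs, abs_of_nonneg (hφ0 v)]
  · have : 𝓕 (𝓕 B) ξ = B (-ξ) := by
      rw [← neg_neg ξ, ← fourierInv_eq_fourier_neg (𝓕 B) (-ξ)]; simp
    rw [this, hB]
    by_contra hne
    have := hsup (-ξ) (by simpa using hne)
    rw [norm_neg] at this
    linarith
  · have := norm_fourier_sub_integral_le hφi hφ0 (ω := x) (c := ε * ‖x‖) fun v hv =>
      (abs_real_inner_le_norm v x).trans (by gcongr; exact hsup v hv)
    rw [hφ1] at this
    simpa [SchwartzMap.fourier_coe, hB] using this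

/-! ### Tilings by translates of a convex symmetric set -/

theorem ennreal_sq_sum_le_card_mul {ι : Type*} (s : Finset ι) (a : ι → ℝ≥0∞) :
    (∑ i ∈ s, a i) ^ 2 ≤ s.card * ∑ i ∈ s, a i ^ 2 := by
  have := ENNReal.rpow_sum_le_const_mul_sum_rpow s a (p := 2) (by norm_num)
  norm_num at this
  exact this

section Tiling

variable {U V : Set E3}

theorem lintegral_biUnion_finset_le_sum {ι : Type*} (s : Finset ι) (t : ι → Set E3)
    (g : E3 → ℝ≥0∞) : ∫⁻ x in ⋃ i ∈ s, t i, g x ≤ ∑ i ∈ s, ∫⁻ x in t i, g x := by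
  classical
  induction s using Finset.induction_on with
  | empty => simp
  | insert i s hi ih =>
    rw [Finset.set_biUnion_insert, Finset.sum_insert hi]
    exact (lintegral_union_le _ _ _).trans (by gcongr)

theorem add_smul_subset_of_mem (hU : Convex ℝ U) {a : ℝ} (ha : 0 ≤ a) {x v : E3}
    (h : v - x ∈ a • U) : v +ᵥ U ⊆ x +ᵥ (a + 1) • U := by
  rintro _ ⟨u, hu, rfl⟩
  obtain ⟨w, hw, hwx⟩ := h
  rw [hU.add_smul ha zero_le_one, one_smul]
  refine ⟨v - x + u, Set.add_mem_add ⟨w, hw, hwx⟩ hu, ?_⟩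
  simp only [vadd_eq_add]; abel

/-- The tiles are essentially disjoint and all lie in `x + 3U`, whose volume is `27 |U|`. -/
theorem IsTiling.card_le (hV : IsTiling U V) (hU : Convex ℝ U) (hm : MeasurableSet U)
    (h0 : volume U ≠ 0) (ht : volume U ≠ ⊤) (x : E3) (F : Finset E3)
    (hF : ∀ v ∈ F, v ∈ V ∧ v - x ∈ (2 : ℝ) • U) : F.card ≤ 27 := by
  have h1 : volume (⋃ v ∈ F, v +ᵥ U) = ∑ v ∈ F, volume (v +ᵥ U) := by
    refine measure_biUnion_finset₀ ?_ fun v _ => (hm.const_vadd v).nullMeasurableSet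
    intro v hv w hw hvw
    exact hV.disjoint (hF v hv).1 (hF w hw).1 hvw
  have h2 : volume (⋃ v ∈ F, v +ᵥ U) ≤ volume (x +ᵥ ((2 : ℝ) + 1) • U) :=
    measure_mono (Set.iUnion₂_subset fun v hv =>
      add_smul_subset_of_mem hU zero_le_two (hF v hv).2)
  rw [h1] at h2
  simp only [measure_vadd, Finset.sum_const, nsmul_eq_mul, Measure.addHaar_smul,
    finrank_euclideanSpace_fin] at h2
  have h3 := (ENNReal.mul_le_mul_iff_left h0 ht).1 h2
  have h4 : ENNReal.ofReal |((2 : ℝ) + 1) ^ 3| = ((27 : ℕ) : ℝ≥0∞) := by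
    rw [← ENNReal.ofReal_natCast]; norm_num
  rw [h4] at h3
  exact_mod_cast h3

theorem IsTiling.countable (hV : IsTiling U V) (hm : MeasurableSet U) (h0 : volume U ≠ 0) :
    Countable V := by
  have := Measure.countable_meas_pos_of_disjoint_iUnion₀ (μ := (volume : Measure E3))
    (As := fun v : V => (v : E3) +ᵥ U) (fun v => (hm.const_vadd (v : E3)).nullMeasurableSet)
    (fun v w hvw => hV.disjoint v.2 w.2 (Subtype.coe_injective.ne hvw))
  have huniv : {v : V | 0 < (volume : Measure E3) ((v : E3) +ᵥ U)} = Set.univ := by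
    ext v
    simp [pos_iff_ne_zero, h0]
  rw [huniv] at this
  exact Set.countable_univ_iff.1 this

/-- The square function of averages over all translates of `U` is controlled by the averages over
the translates in a tiling. -/
theorem IsTiling.lintegral_sq_le (hV : IsTiling U V) (hU : Convex ℝ U) (hs : ∀ x ∈ U, -x ∈ U)
    (hm : MeasurableSet U) (h0 : volume U ≠ 0) (ht : volume U ≠ ⊤) (g : E3 → ℝ≥0∞) :
    ∫⁻ x : E3, (∫⁻ t in x +ᵥ U, g t) ^ 2 ≤
      216 * volume U * ∑' v : V, (∫⁻ t in (v : E3) +ᵥ U, g t) ^ 2 := by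
  classical
  set a : V → ℝ≥0∞ := fun v => ∫⁻ t in (v : E3) +ᵥ U, g t with ha
  have hsmul : ∀ x ∈ (2 : ℝ) • U, -x ∈ (2 : ℝ) • U := by
    rintro _ ⟨u, hu, rfl⟩
    exact ⟨-u, hs u hu, by simp⟩
  -- By symmetry and convexity, every tile meeting `x + U` has `v - x ∈ 2U`, so at most 27 tiles
  -- matter and Cauchy–Schwarz costs 27. Integrating the indicator in `x` costs `|2U| = 8 |U|`,
  -- whence `216 = 27 * 8`.
  have hpt : ∀ x : E3, (∫⁻ t in x +ᵥ U, g t) ^ 2 ≤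
      27 * ∑' v : V, ((v : E3) +ᵥ (2 : ℝ) • U).indicator (fun _ => a v ^ 2) x := by
    intro x
    set N : Set V := {v : V | (v : E3) - x ∈ (2 : ℝ) • U} with hN
    have hcard : ∀ F : Finset V, (F : Set V) ⊆ N → F.card ≤ 27 := by
      intro F hF
      rw [← Finset.card_map (Function.Embedding.subtype _)]
      refine hV.card_le hU hm h0 ht x _ fun v hv => ?_
      obtain ⟨w, hw, rfl⟩ := Finset.mem_map.1 hv
      exact ⟨w.2, hF hw⟩
    have hfin : N.Finite := by
      by_contra hinf
      obtain ⟨F, hF, hc⟩ := Set.Infinite.exists_subset_card_eq hinf 28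
      have := hcard F hF
      omega
    have hcov : x +ᵥ U ⊆ ⋃ v ∈ hfin.toFinset, (v : E3) +ᵥ U := by
      rintro _ ⟨u, hu, rfl⟩
      obtain ⟨v, hv, w, hw, hvw⟩ := hV.cover (x + u)
      refine Set.mem_iUnion₂.2 ⟨⟨v, hv⟩, ?_, w, hw, hvw⟩
      simp only [Set.Finite.mem_toFinset, hN, Set.mem_ofPred_eq]
      have h2 : v - x = u + -w := by
        simp only [vadd_eq_add] at hvw
        rw [eq_sub_of_add_eq hvw]; abel
      have h3 : (2 : ℝ) • U = U + U := by
        have := hU.add_smul zero_le_one zero_le_one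
        rwa [one_add_one_eq_two, one_smul] at this
      rw [h2, h3]
      exact Set.add_mem_add hu (hs w hw)
    have h1 : ∫⁻ t in x +ᵥ U, g t ≤ ∑ v ∈ hfin.toFinset, a v :=
      (lintegral_mono_set hcov).trans (lintegral_biUnion_finset_le_sum _ _ _)
    calc (∫⁻ t in x +ᵥ U, g t) ^ 2 ≤ (∑ v ∈ hfin.toFinset, a v) ^ 2 := by gcongr
      _ ≤ hfin.toFinset.card * ∑ v ∈ hfin.toFinset, a v ^ 2 :=
        ennreal_sq_sum_le_card_mul _ _
      _ ≤ 27 * ∑ v ∈ hfin.toFinset, a v ^ 2 := by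
        gcongr
        exact_mod_cast hcard _ (by simp)
      _ = 27 * ∑ v ∈ hfin.toFinset,
          ((v : E3) +ᵥ (2 : ℝ) • U).indicator (fun _ => a v ^ 2) x := by
        congr 1
        refine Finset.sum_congr rfl fun v hv => ?_
        rw [Set.indicator_of_mem]
        refine ⟨x - v, ?_, by simp⟩
        rw [Set.Finite.mem_toFinset] at hv
        simpa using hsmul _ hv
      _ ≤ _ := by
        gcongr
        exact ENNReal.sum_le_tsum _
  have := hV.countable hm h0
  have hm2 : MeasurableSet ((2 : ℝ) • U) := hm.const_smul₀ 2
  calc ∫⁻ x : E3, (∫⁻ t in x +ᵥ U, g t) ^ 2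
      ≤ ∫⁻ x, 27 * ∑' v : V, ((v : E3) +ᵥ (2 : ℝ) • U).indicator (fun _ => a v ^ 2) x :=
        lintegral_mono hpt
    _ = 27 * ∑' v : V, a v ^ 2 * (8 * volume U) := by
        rw [lintegral_const_mul' _ _ (by simp), lintegral_tsum fun v =>
          (measurable_const.indicator (hm2.const_vadd _)).aemeasurable]
        congr 2
        ext v
        rw [lintegral_indicator_const (hm2.const_vadd _), measure_vadd, Measure.addHaar_smul,
          finrank_euclideanSpace_fin]
        norm_num
    _ = _ := by
        rw [ENNReal.tsum_mul_right]
        ring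

end Tiling

/-! ### Coverings by balls -/

theorem sq_setLIntegral_le {f : E3 → ℝ≥0∞} (hf : Measurable f) (B : Set E3) :
    (∫⁻ x in B, f x) ^ 2 ≤ volume B * ∫⁻ x in B, f x ^ 2 := by
  have h := ENNReal.lintegral_mul_le_Lp_mul_Lq (volume.restrict B) Real.HolderConjugate.two_two
    (f := fun _ => 1) (g := f) aemeasurable_const hf.aemeasurable
  simp only [Pi.mul_apply, one_mul, lintegral_const, Measure.restrict_apply, one_pow,
    MeasurableSet.univ, Set.univ_inter, ENNReal.rpow_ofNat] at h
  calc (∫⁻ x in B, f x) ^ 2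
      ≤ (volume B ^ (1 / 2 : ℝ) * (∫⁻ x in B, f x ^ 2) ^ (1 / 2 : ℝ)) ^ 2 := by gcongr
    _ = _ := by
      rw [mul_pow, ← ENNReal.rpow_natCast, ← ENNReal.rpow_natCast, ← ENNReal.rpow_mul,
        ← ENNReal.rpow_mul]
      norm_num

/-- Cauchy–Schwarz cancels the factor `|B_r|⁻¹`, and the overlap bound sums the balls. -/
theorem IsBallCover.tsum_le {M : ℕ} {r : ℝ} {V : Set E3} (hV : IsBallCover M r V)
    {f : E3 → ℝ≥0∞} (hf : Measurable f) :
    ∑' v : V, (volume (Metric.closedBall (v : E3) r))⁻¹ *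
      (∫⁻ x in Metric.closedBall (v : E3) r, f x) ^ 2 ≤ M * ∫⁻ x, f x ^ 2 := by
  classical
  have h1 : ∀ v : V, (volume (Metric.closedBall (v : E3) r))⁻¹ *
      (∫⁻ x in Metric.closedBall (v : E3) r, f x) ^ 2 ≤
      ∫⁻ x, (Metric.closedBall (v : E3) r).indicator (fun x => f x ^ 2) x := by
    intro v
    rw [lintegral_indicator Metric.isClosed_closedBall.measurableSet]
    grw [sq_setLIntegral_le hf]
    rw [← mul_assoc]
    exact mul_le_of_le_one_left' (ENNReal.inv_mul_le_one _)
  refine (ENNReal.tsum_le_tsum h1).trans ?_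
  rw [ENNReal.tsum_eq_iSup_sum]
  refine iSup_le fun F => ?_
  rw [← lintegral_finsetSum _ fun v _ =>
    (hf.pow_const 2).indicator Metric.isClosed_closedBall.measurableSet,
    ← lintegral_const_mul' _ _ (by simp)]
  refine lintegral_mono fun x => ?_
  simp only [Set.indicator_apply, ← Finset.sum_filter, Finset.sum_const, nsmul_eq_mul]
  gcongr
  have h2 := hV.overlap x
  have h3 : (((F.filter fun v : V => x ∈ Metric.closedBall (v : E3) r).map
      (Function.Embedding.subtype _) : Finset E3) : Set E3) ⊆
      {v ∈ V | x ∈ Metric.closedBall v r} := by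
    intro w hw
    simp only [Finset.coe_map, Set.mem_image, Finset.mem_coe, Finset.mem_filter] at hw
    obtain ⟨v, ⟨_, hv⟩, rfl⟩ := hw
    exact ⟨v.2, hv⟩
  have h4 := (Set.encard_le_encard h3).trans h2
  rw [Set.encard_coe_eq_coe_finsetCard, Finset.card_map] at h4
  exact_mod_cast h4

/-! ### The boxes -/

theorem inner_core (η : ℝ) (x : E3) : inner ℝ (core η) x = η ^ 2 / 2 * x 0 + η * x 1 + x 2 := by
  simp [core, PiLp.inner_apply, Fin.sum_univ_three]; ring

theorem inner_normal (η : ℝ) (x : E3) :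
    inner ℝ (normal η) x = x 0 - η * x 1 + η ^ 2 / 2 * x 2 := by
  simp [normal, PiLp.inner_apply, Fin.sum_univ_three]; ring

theorem inner_tangent (η : ℝ) (x : E3) :
    inner ℝ (tangent η) x = η * x 0 + (1 - η ^ 2 / 2) * x 1 - η * x 2 := by
  simp [tangent, PiLp.inner_apply, Fin.sum_univ_three]; ring

/-- Parseval's identity for the orthogonal frame of core, normal and tangent vectors. -/
theorem inner_frame (η : ℝ) (x y : E3) :
    inner ℝ (core η) x * inner ℝ (core η) y + inner ℝ (normal η) x * inner ℝ (normal η) y +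
      inner ℝ (tangent η) x * inner ℝ (tangent η) y = (1 + η ^ 2 / 2) ^ 2 * inner ℝ x y := by
  have h : inner ℝ x y = x 0 * y 0 + x 1 * y 1 + x 2 * y 2 := by
    simp [PiLp.inner_apply, Fin.sum_univ_three]; ring
  rw [h]
  simp only [inner_core, inner_normal, inner_tangent]
  ring

theorem abs_inner_le_frame (η : ℝ) (x y : E3) :
    |inner ℝ x y| ≤ |inner ℝ (core η) x| * |inner ℝ (core η) y| +
      |inner ℝ (normal η) x| * |inner ℝ (normal η) y| +
      |inner ℝ (tangent η) x| * |inner ℝ (tangent η) y| := by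
  have h1 : 1 ≤ (1 + η ^ 2 / 2) ^ 2 := one_le_pow₀ (by nlinarith [sq_nonneg η])
  calc |inner ℝ x y| ≤ (1 + η ^ 2 / 2) ^ 2 * |inner ℝ x y| :=
        le_mul_of_one_le_left (abs_nonneg _) h1
    _ = |(1 + η ^ 2 / 2) ^ 2 * inner ℝ x y| := by
      rw [abs_mul, abs_of_nonneg (a := (1 + η ^ 2 / 2) ^ 2) (by positivity)]
    _ ≤ _ := by
      rw [← inner_frame, ← abs_mul, ← abs_mul, ← abs_mul]
      exact abs_add_three _ _ _

variable {ρ s η : ℝ}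

theorem isClosed_box : IsClosed (box ρ s η) := by
  simp only [box, Set.ofPred_and]
  refine (isClosed_le ?_ continuous_const).inter
    ((isClosed_le ?_ continuous_const).inter (isClosed_le ?_ continuous_const)) <;> fun_prop

theorem convex_box : Convex ℝ (box ρ s η) := by
  have h : ∀ (e : E3) (c : ℝ), Convex ℝ {x : E3 | |inner ℝ e x| ≤ c} := by
    intro e c
    have : {x : E3 | |inner ℝ e x| ≤ c} = (innerSL ℝ e) ⁻¹' Set.Icc (-c) c := by
      ext x; simp [abs_le]
    rw [this]
    exact (convex_Icc _ _).linear_preimage (innerSL ℝ e : E3 →ₗ[ℝ] ℝ)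
  exact (h _ _).inter ((h _ _).inter (h _ _))

theorem neg_mem_box {x : E3} (hx : x ∈ box ρ s η) : -x ∈ box ρ s η := by
  simpa [box] using hx

theorem smul_box {c : ℝ} (hc : 0 < c) : c • box ρ s η = box (c * ρ) s η := by
  ext x
  rw [Set.mem_smul_set_iff_inv_smul_mem₀ hc.ne']
  simp only [box, Set.mem_ofPred_eq, inner_smul_right, abs_mul, abs_of_pos (inv_pos.2 hc),
    inv_mul_le_iff₀ hc, mul_assoc]

theorem isBounded_box : Bornology.IsBounded (box ρ s η) := by
  refine (Metric.isBounded_closedBall (x := (0 : E3)) (r :=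
    |ρ * s ^ 2| + |ρ| + |ρ * s|)).subset fun x hx => ?_
  obtain ⟨h1, h2, h3⟩ := hx
  rw [mem_closedBall_zero_iff]
  have h1 := h1.trans (le_abs_self _)
  have h2 := h2.trans (le_abs_self _)
  have h3 := h3.trans (le_abs_self _)
  have h4 := abs_inner_le_frame η x x
  rw [real_inner_self_eq_norm_sq, abs_of_nonneg (by positivity)] at h4
  refine abs_le_of_sq_le_sq' ?_ (by positivity) |>.2
  have := abs_nonneg (inner ℝ (core η) x)
  have := abs_nonneg (inner ℝ (normal η) x)
  have := abs_nonneg (inner ℝ (tangent η) x)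
  nlinarith [mul_le_mul h1 h1 (by positivity) (by positivity),
    mul_le_mul h2 h2 (by positivity) (by positivity),
    mul_le_mul h3 h3 (by positivity) (by positivity),
    mul_nonneg (abs_nonneg (ρ * s ^ 2)) (abs_nonneg ρ),
    mul_nonneg (abs_nonneg (ρ * s ^ 2)) (abs_nonneg (ρ * s)),
    mul_nonneg (abs_nonneg ρ) (abs_nonneg (ρ * s))]

theorem volume_box_ne_top : volume (box ρ s η) ≠ ⊤ := isBounded_box.measure_lt_top.ne

theorem volume_box_ne_zero (hρ : 0 < ρ) (hs : 0 < s) : volume (box ρ s η) ≠ 0 := by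
  have ho : IsOpen {x : E3 | |inner ℝ (core η) x| < ρ * s ^ 2 ∧ |inner ℝ (normal η) x| < ρ ∧
      |inner ℝ (tangent η) x| < ρ * s} := by
    simp only [Set.ofPred_and]
    refine (isOpen_lt ?_ continuous_const).inter
      ((isOpen_lt ?_ continuous_const).inter (isOpen_lt ?_ continuous_const)) <;> fun_prop
  refine ((ho.measure_pos volume ⟨0, ?_⟩).trans_le (measure_mono ?_)).ne'
  · simp only [Set.mem_ofPred_eq, inner_zero_right, abs_zero]
    exact ⟨by positivity, hρ, by positivity⟩
  · exact fun x hx => ⟨hx.1.le, hx.2.1.le, hx.2.2.le⟩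

/-- A product of three one-dimensional bumps in the frame coordinates; it equals `1` on `(c / 2) U`,
which bounds its integral below. It serves as the averaging kernel in `setLIntegral_fourier_le`. -/
theorem exists_box_bump (hρ : 0 < ρ) (hs : 0 < s) (η : ℝ) {c : ℝ} (hc : 0 < c) :
    ∃ φ : E3 → ℝ, ContDiff ℝ (⊤ : ℕ∞) φ ∧ HasCompactSupport φ ∧ (∀ x, 0 ≤ φ x) ∧ (∀ x, φ x ≤ 1) ∧
      (∀ x, φ x ≠ 0 → x ∈ box (c * ρ) s η) ∧
      (c / 2) ^ 3 * volume.real (box ρ s η) ≤ ∫ x, φ x := by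
  let b : ContDiffBump (0 : ℝ) := ⟨1 / 2, 1, by norm_num, by norm_num⟩
  let φ : E3 → ℝ := fun x => b (inner ℝ (core η) x / (c * ρ * s ^ 2)) *
    b (inner ℝ (normal η) x / (c * ρ)) * b (inner ℝ (tangent η) x / (c * ρ * s))
  have hsupp : ∀ x, φ x ≠ 0 → x ∈ box (c * ρ) s η := by
    have key : ∀ {t a : ℝ}, 0 < a → b (t / a) ≠ 0 → |t| ≤ a := by
      intro t a ha h
      have : t / a ∈ Function.support b := h
      rw [b.support_eq] at this
      have h2 : |t / a| < 1 := mem_ball_zero_iff.1 this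
      rw [abs_div, abs_of_pos ha, div_lt_one ha] at h2
      exact h2.le
    intro x hx
    have h1 := mul_ne_zero_iff.1 hx
    have h2 := mul_ne_zero_iff.1 h1.1
    exact ⟨key (by positivity) h2.1, key (by positivity) h2.2, key (by positivity) h1.2⟩
  have hcd : ContDiff ℝ (⊤ : ℕ∞) φ := by
    have h : ∀ (e : E3) (a : ℝ), ContDiff ℝ (⊤ : ℕ∞) fun x : E3 => b (inner ℝ e x / a) :=
      fun e a => b.contDiff.comp (((innerSL ℝ e).contDiff).div_const a)
    exact ((h _ _).mul (h _ _)).mul (h _ _)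
  have hcomp : HasCompactSupport φ := by
    refine HasCompactSupport.intro (K := box (c * ρ) s η)
      (Metric.isCompact_of_isClosed_isBounded isClosed_box isBounded_box) fun x hx => ?_
    by_contra hne
    exact hx (hsupp x hne)
  have h0 : ∀ x, 0 ≤ φ x := fun x => by
    have := fun t => b.nonneg (x := t)
    exact mul_nonneg (mul_nonneg (this _) (this _)) (this _)
  have h1 : ∀ x, φ x ≤ 1 := fun x => by
    have h0 := fun t => b.nonneg (x := t)
    have h1 := fun t => b.le_one (x := t)
    exact mul_le_one₀ (mul_le_one₀ (h1 _) (h0 _) (h1 _)) (h0 _) (h1 _)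
  have hint : Integrable φ := hcd.continuous.integrable_of_hasCompactSupport hcomp
  refine ⟨φ, hcd, hcomp, h0, h1, hsupp, ?_⟩
  have hone : ∀ x ∈ (c / 2) • box ρ s η, φ x = 1 := by
    have key : ∀ {t a : ℝ}, 0 < a → |t| ≤ a / 2 → b (t / a) = 1 := by
      intro t a ha h
      refine b.one_of_mem_closedBall ?_
      rw [mem_closedBall_zero_iff, Real.norm_eq_abs, abs_div, abs_of_pos ha, div_le_iff₀ ha]
      change |t| ≤ 1 / 2 * a
      linarith
    intro x hx
    rw [smul_box (by positivity)] at hx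
    obtain ⟨hx1, hx2, hx3⟩ := hx
    simp only [φ]
    rw [key (by positivity) (by linarith), key (by positivity) (by linarith),
      key (by positivity) (by linarith)]
    norm_num
  have hm : MeasurableSet ((c / 2) • box ρ s η) := isClosed_box.measurableSet.const_smul₀ _
  calc (c / 2) ^ 3 * volume.real (box ρ s η) = volume.real ((c / 2) • box ρ s η) := by
        rw [Measure.real, Measure.real, Measure.addHaar_smul, finrank_euclideanSpace_fin,
          ENNReal.toReal_mul, ENNReal.toReal_ofReal (abs_nonneg _), abs_of_pos (by positivity)]
    _ = ∫ x in (c / 2) • box ρ s η, φ x := by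
        rw [setIntegral_congr_fun hm hone]; simp
    _ ≤ ∫ x, φ x := setIntegral_le_integral hint (Filter.Eventually.of_forall h0)

/-! ### Directions -/

theorem card_le_of_separated {D : Finset ℝ} {s : ℝ} (hs : 0 < s)
    (hD : ∀ x ∈ D, ∀ y ∈ D, x ≠ y → s ≤ |x - y|) {p : ℝ} {L : ℕ}
    (h : ∀ x ∈ D, |x - p| ≤ L * s) : D.card ≤ 2 * L + 1 := by
  have hc : (Finset.Icc (-(L : ℤ)) L).card = 2 * L + 1 := by
    rw [Int.card_Icc]; omega
  rw [← hc]
  refine Finset.card_le_card_of_injOn (fun x => ⌊(x - p) / s⌋) (fun x hx => ?_) ?_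
  · have h1 := abs_le.1 (h x hx)
    simp only [Finset.coe_Icc, Set.mem_Icc]
    constructor
    · rw [Int.le_floor, le_div_iff₀ hs]; push_cast; linarith
    · rw [← Int.lt_add_one_iff, Int.floor_lt, div_lt_iff₀ hs]; push_cast; linarith
  · intro x hx y hy hxy
    by_contra hne
    have h1 := Int.abs_sub_lt_one_of_floor_eq_floor hxy
    rw [← sub_div, abs_div, abs_of_pos hs, div_lt_one hs, sub_sub_sub_cancel_right] at h1
    exact absurd (hD x hx y hy hne) (not_le.2 h1)

theorem directions_one : directions 1 = {0} := by simp [directions]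

theorem abs_le_one_of_mem_directions {s η : ℝ} (hs : 0 < s) (hs1 : s ≤ 1)
    (hη : η ∈ directions s) : |η| ≤ 1 := by
  obtain ⟨i, hi, rfl⟩ := Finset.mem_image.1 hη
  have hi1 : (i : ℝ) + 1 ≤ ⌈s⁻¹⌉₊ := by exact_mod_cast Finset.mem_range.1 hi
  set n : ℝ := (⌈s⁻¹⌉₊ : ℝ)
  have h1 : 0 ≤ 2 * (i : ℝ) / (n - 1) := div_nonneg (by positivity)
    (by linarith [i.cast_nonneg (α := ℝ)])
  have h2 : 2 * (i : ℝ) / (n - 1) ≤ 2 := by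
    refine div_le_of_le_mul₀ (by linarith [i.cast_nonneg (α := ℝ)]) zero_le_two (by linarith)
  rw [abs_mul, abs_of_nonneg (by linarith)]
  refine mul_le_one₀ (by linarith) (abs_nonneg _) (abs_le.2 ⟨by linarith, by linarith⟩)

/-- The spacing is `2 (1 - s) / (n - 1)` with `n - 1 ≤ 1 / s`, which is at least `s` for `s ≤ 1 /
2`. For `2 / 3 < s < 1` the two directions `±(1 - s)` would be too close; dyadic apertures avoid
that range. -/
theorem directions_separated {s : ℝ} (hs : 0 < s) (hs1 : s = 1 ∨ s ≤ 1 / 2) :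
    ∀ x ∈ directions s, ∀ y ∈ directions s, x ≠ y → s ≤ |x - y| := by
  rcases hs1 with rfl | hs1
  · simp [directions_one]
  intro x hx y hy hxy
  obtain ⟨i, hi, rfl⟩ := Finset.mem_image.1 hx
  obtain ⟨j, hj, rfl⟩ := Finset.mem_image.1 hy
  have hij : i ≠ j := fun h => hxy (by rw [h])
  have h2 : (2 : ℝ) ≤ ⌈s⁻¹⌉₊ := by
    refine le_trans ?_ (Nat.le_ceil _)
    rw [le_inv_comm₀ zero_lt_two hs]
    linarith
  have h3 : ((⌈s⁻¹⌉₊ : ℝ) - 1) * s ≤ 1 := by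
    have := Nat.ceil_lt_add_one (inv_nonneg.2 hs.le)
    rw [← le_div_iff₀ hs, one_div]
    linarith
  set n : ℝ := (⌈s⁻¹⌉₊ : ℝ)
  have h4 : (1 : ℝ) ≤ |(i : ℝ) - j| := by
    have : (1 : ℤ) ≤ |(i : ℤ) - j| := Int.one_le_abs (by omega)
    exact_mod_cast this
  have h5 : (1 - s) * (2 * (i : ℝ) / (n - 1) - 1) - (1 - s) * (2 * (j : ℝ) / (n - 1) - 1) =
      2 * (1 - s) / (n - 1) * (i - j) := by
    field_simp
    ring
  have h6 : s ≤ 2 * (1 - s) / (n - 1) := by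
    rw [le_div_iff₀ (by linarith)]
    nlinarith
  have h7 : |2 * (1 - s) / (n - 1)| = 2 * (1 - s) / (n - 1) :=
    abs_of_nonneg (div_nonneg (by linarith) (by linarith))
  rw [h5, abs_mul, h7]
  nlinarith

/-! ### Geometry of the sectors -/

/-- A slight enlargement of the sector of aperture `s` in the case `K = s⁻²`. -/
def fatSector (s η : ℝ) : Set E3 :=
  {ω | |ω 2 - 1| ≤ 3 * s ^ 2 ∧ |ω 1 - η * ω 2| ≤ 4 * s ∧
    |ω 0 - η * ω 1 + η ^ 2 / 2 * ω 2| ≤ 3 * s ^ 2}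

/-- A box containing all differences of elements of `fatSector s η`. -/
def diffBox (s η : ℝ) : Set E3 :=
  {ω | |ω 2| ≤ 6 * s ^ 2 ∧ |ω 1 - η * ω 2| ≤ 8 * s ∧
    |ω 0 - η * ω 1 + η ^ 2 / 2 * ω 2| ≤ 6 * s ^ 2}

variable {s σ η η' ζ : ℝ}

theorem sub_mem_diffBox {α β : E3} (hα : α ∈ fatSector s η) (hβ : β ∈ fatSector s η) :
    α - β ∈ diffBox s η := by
  obtain ⟨a1, a2, a3⟩ := hα
  obtain ⟨b1, b2, b3⟩ := hβ
  simp only [abs_le] at a1 a2 a3 b1 b2 b3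
  simp only [diffBox, Set.mem_ofPred_eq, PiLp.sub_apply, abs_le]
  refine ⟨⟨?_, ?_⟩, ⟨?_, ?_⟩, ?_, ?_⟩ <;> linarith

/-- Absorbs the widening of Fourier supports caused by the cutoffs. -/
theorem mem_fatSector {K ε : ℝ} (hs : 0 < s) (hs1 : s ≤ 1) (hK : 1 / K = s ^ 2) (hη : |η| ≤ 1)
    (hε : ε ≤ s ^ 2 / 3) {ω ν : E3} (hν : ν ∈ sector K s η) (h : ‖ω - ν‖ ≤ ε) :
    ω ∈ fatSector s η := by
  obtain ⟨h1, h2, h3⟩ := hν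
  rw [hK] at h1
  have hc : ∀ i, |ω i - ν i| ≤ s ^ 2 / 3 := fun i =>
    ((PiLp.norm_apply_le (ω - ν) i).trans h).trans hε
  have hss : s ^ 2 ≤ s := by nlinarith
  have c1 : |η * (ω 1 - ν 1)| ≤ s ^ 2 / 3 := by
    rw [abs_mul]; exact (mul_le_of_le_one_left (abs_nonneg _) hη).trans (hc 1)
  have c2 : |η * (ω 2 - ν 2)| ≤ s ^ 2 / 3 := by
    rw [abs_mul]; exact (mul_le_of_le_one_left (abs_nonneg _) hη).trans (hc 2)
  have c3 : |η ^ 2 * (ω 2 - ν 2)| ≤ s ^ 2 / 3 := by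
    rw [abs_mul, abs_pow]
    exact (mul_le_of_le_one_left (abs_nonneg _) (pow_le_one₀ (abs_nonneg _) hη)).trans (hc 2)
  have c4 := hc 0
  have c5 := hc 1
  have c6 := hc 2
  simp only [abs_le] at h1 h2 h3 c1 c2 c3 c4 c5 c6
  simp only [fatSector, Set.mem_ofPred_eq, abs_le]
  refine ⟨⟨?_, ?_⟩, ⟨?_, ?_⟩, ?_, ?_⟩ <;> nlinarith

/-- At a common point `(η - ζ) ω₃` is at most `3 s + 3 σ ≤ 6 σ`, while `ω₃ ≥ 8 / 10`; and `6 / 0.8 <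
8`. -/
theorem abs_sub_le_of_sectors_meet {K : ℝ} (hs : 0 < s) (hs1 : s ^ 2 ≤ 1 / 10) (hsσ : s ≤ σ)
    (hK : 1 / K = s ^ 2) (h : (sector K s η ∩ sector K σ ζ).Nonempty) : |η - ζ| ≤ 8 * σ := by
  obtain ⟨ω, ⟨h1, h2, _⟩, _, h4, _⟩ := h
  rw [hK] at h1
  have h5 : |(η - ζ) * ω 2| ≤ 6 * σ := by
    rw [abs_le] at *
    constructor <;> nlinarith
  have h6 : 8 / 10 ≤ |ω 2| := by
    rw [abs_le] at h1
    exact le_trans (by linarith) (le_abs_self _)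
  rw [abs_mul] at h5
  nlinarith [abs_nonneg (η - ζ)]

/-- Points of a sector lie close to the parabola `2 ω 0 = ω 1 ^ 2`. -/
theorem near_parabola (hs : 0 < s) (hs1 : s ≤ 1) (hη : |η| ≤ 1) {α : E3}
    (hα : α ∈ fatSector s η) :
    |α 1 - η| ≤ 7 * s ∧ |2 * α 0 - α 1 ^ 2| ≤ 58 * s ^ 2 := by
  obtain ⟨h1, h2, h3⟩ := hα
  have hss : s ^ 2 ≤ s := by nlinarith
  have c1 : |η * (α 2 - 1)| ≤ 3 * s ^ 2 := by
    rw [abs_mul]; exact (mul_le_of_le_one_left (abs_nonneg _) hη).trans h1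
  have c2 : |η ^ 2 * (1 - α 2)| ≤ 3 * s ^ 2 := by
    rw [abs_mul, abs_pow, abs_sub_comm]
    exact (mul_le_of_le_one_left (abs_nonneg _) (pow_le_one₀ (abs_nonneg _) hη)).trans h1
  have h4 : |α 1 - η| ≤ 7 * s := by
    rw [abs_le] at *
    constructor <;> linarith
  refine ⟨h4, ?_⟩
  have h5 : (α 1 - η) ^ 2 ≤ 49 * s ^ 2 := by
    rw [← sq_abs]; nlinarith [abs_nonneg (α 1 - η)]
  -- The three terms are at most `49 s ^ 2`, `3 s ^ 2` and `6 s ^ 2`, with sum `58 s ^ 2`.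
  have h6 : 2 * α 0 - α 1 ^ 2 = -(α 1 - η) ^ 2 + η ^ 2 * (1 - α 2) +
      2 * (α 0 - η * α 1 + η ^ 2 / 2 * α 2) := by ring
  rw [h6]
  rw [abs_le] at *
  constructor <;> nlinarith [sq_nonneg (α 1 - η)]

/-- If `ω` is a sum of points of two sectors, then both directions are essentially determined by
`ω`, up to order. -/
theorem direction_of_add (hs : 0 < s) (hs1 : s ≤ 1) (hη : |η| ≤ 1) (hη' : |η'| ≤ 1) {α β ω : E3}
    (hα : α ∈ fatSector s η) (hβ : β ∈ fatSector s η') (hω : α + β = ω) :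
    |η - (ω 1 + √(4 * ω 0 - ω 1 ^ 2)) / 2| ≤ 15 * s ∨
      |η - (ω 1 - √(4 * ω 0 - ω 1 ^ 2)) / 2| ≤ 15 * s := by
  obtain ⟨a1, a2⟩ := near_parabola hs hs1 hη hα
  obtain ⟨_, b2⟩ := near_parabola hs hs1 hη' hβ
  have w0 : ω 0 = α 0 + β 0 := by rw [← hω]; rfl
  have w1 : ω 1 = α 1 + β 1 := by rw [← hω]; rfl
  set q := √(4 * ω 0 - ω 1 ^ 2) with hq
  have hq0 : 0 ≤ q := Real.sqrt_nonneg _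
  -- For points exactly on the parabola the difference vanishes, because `(a - b)² = 2 (a² + b²) -
  -- (a + b)²`. The errors add up to `4 * 58 s ^ 2`.
  have h1 : |(α 1 - β 1) ^ 2 - (4 * ω 0 - ω 1 ^ 2)| ≤ 232 * s ^ 2 := by
    rw [w0, w1]
    rw [abs_le] at *
    constructor <;> nlinarith
  -- Here `232 ≤ 16 ^ 2`. Half of this error plus `|α 1 - η| ≤ 7 s` gives the final `15 s`.
  have key : ∀ a : ℝ, 0 ≤ a → a ^ 2 = (α 1 - β 1) ^ 2 → |a - q| ≤ 16 * s := by
    intro a ha hab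
    rw [← hab] at h1
    refine abs_le_of_sq_le_sq ?_ (by positivity)
    rcases le_total 0 (4 * ω 0 - ω 1 ^ 2) with hD | hD
    · rw [← Real.sq_sqrt hD, ← hq, sq_sub_sq, abs_mul, abs_of_nonneg (by positivity)] at h1
      have : |a - q| ≤ a + q := abs_le.2 ⟨by linarith, by linarith⟩
      rw [← sq_abs]
      nlinarith [abs_nonneg (a - q)]
    · have : q = 0 := Real.sqrt_eq_zero_of_nonpos hD
      rw [this, sub_zero]
      rw [abs_le] at h1
      nlinarith
  rcases le_total (β 1) (α 1) with hle | hle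
  · left
    have := key (α 1 - β 1) (by linarith) rfl
    rw [abs_le] at *
    constructor <;> linarith
  · right
    have := key (β 1 - α 1) (by linarith) (by ring)
    rw [abs_le] at *
    constructor <;> linarith

/-- Each entry of a pair lies within `15 s` of one of the two roots determined by `ω`, and
`s`-separation allows at most `31` directions near each root. -/
theorem card_pairs_le {D : Finset ℝ} (hs : 0 < s) (hs1 : s ≤ 1)
    (hsep : ∀ x ∈ D, ∀ y ∈ D, x ≠ y → s ≤ |x - y|) (hD : ∀ x ∈ D, |x| ≤ 1) (ω : E3)
    (P : Finset (ℝ × ℝ)) (hP : ∀ p ∈ P, p.1 ∈ D ∧ p.2 ∈ D ∧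
      ∃ α β, α ∈ fatSector s p.1 ∧ β ∈ fatSector s p.2 ∧ α + β = ω) : P.card ≤ 62 ^ 2 := by
  classical
  have hcount : ∀ c : ℝ, (D.filter fun η => |η - c| ≤ 15 * s).card ≤ 31 := fun c =>
    card_le_of_separated (L := 15) hs (fun x hx y hy =>
      hsep x (Finset.filter_subset _ _ hx) y (Finset.filter_subset _ _ hy))
      (p := c) fun x hx => by exact_mod_cast (Finset.mem_filter.1 hx).2
  set W := (D.filter fun η => |η - (ω 1 + √(4 * ω 0 - ω 1 ^ 2)) / 2| ≤ 15 * s) ∪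
    D.filter fun η => |η - (ω 1 - √(4 * ω 0 - ω 1 ^ 2)) / 2| ≤ 15 * s with hW
  have hWc : W.card ≤ 62 := (Finset.card_union_le _ _).trans
    (Nat.add_le_add (hcount _) (hcount _))
  have hsub : P ⊆ W ×ˢ W := by
    intro p hp
    obtain ⟨h1, h2, α, β, hα, hβ, hω⟩ := hP p hp
    rw [Finset.mem_product, hW, Finset.mem_union, Finset.mem_union]
    simp only [Finset.mem_filter, h1, h2, true_and]
    exact ⟨direction_of_add hs hs1 (hD _ h1) (hD _ h2) hα hβ hω,
      direction_of_add hs hs1 (hD _ h2) (hD _ h1) hβ hα (by rw [add_comm, hω])⟩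
  refine (Finset.card_le_card hsub).trans ?_
  rw [Finset.card_product, sq]
  exact Nat.mul_le_mul hWc hWc

/-- A point of the difference box satisfies `ω₁ = η ω₂ + O(s ^ 2)`, so `η` is the slope `ω₁ / ω₂` up
to `9 s ^ 2 / |ω₂|`; a large `|ω₂|` pins it down to precision `σ`. -/
theorem abs_sub_le_of_mem_diffBox (hσ : 0 < σ) (hη : |η| ≤ 1) (hη' : |η'| ≤ 1) {ω : E3}
    (h : ω ∈ diffBox s η) (h' : ω ∈ diffBox s η') (hω : 14 * s ^ 2 < |ω 1| * σ) :
    |η - η'| ≤ 2 * σ := by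
  have key : ∀ t : ℝ, |t| ≤ 1 → ω ∈ diffBox s t → |ω 0 - t * ω 1| ≤ 9 * s ^ 2 := by
    intro t ht hm
    obtain ⟨h1, _, h3⟩ := hm
    have : |t ^ 2 * ω 2| ≤ 6 * s ^ 2 := by
      rw [abs_mul, abs_pow]
      exact (mul_le_of_le_one_left (abs_nonneg _) (pow_le_one₀ (abs_nonneg _) ht)).trans h1
    rw [abs_le] at *
    constructor <;> linarith
  have h1 := key η hη h
  have h2 := key η' hη' h'
  have h3 : |(η - η') * ω 1| ≤ 18 * s ^ 2 := by
    rw [abs_le] at *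
    constructor <;> linarith
  rw [abs_mul] at h3
  by_contra! hlt
  have h4 : 0 < |ω 1| := by
    by_contra! hle
    nlinarith [sq_nonneg s]
  nlinarith [sq_nonneg s]

/-- The components of a frequency in a slab along the frame in direction `ζ`. -/
theorem frame_le_of_mem_diffBox (hs : 0 < s) (hsσ : s ≤ σ) (hσ1 : σ ≤ 1)
    (hη : |η| ≤ 1) (hζ : |ζ| ≤ 1) (hηζ : |η - ζ| ≤ 8 * σ) {ω : E3}
    (hω : ω ∈ diffBox s η) (hω1 : |ω 1| * σ ≤ 28 * s ^ 2) :
    |inner ℝ (core ζ) ω| * σ ≤ 74 * s ^ 2 ∧ |inner ℝ (tangent ζ) ω| * σ ≤ 74 * s ^ 2 ∧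
      |inner ℝ (normal ζ) ω| ≤ 248 * s ^ 2 := by
  obtain ⟨w2, _, w0⟩ := hω
  have hσ : 0 < σ := hs.trans_le hsσ
  have hss : 0 < s ^ 2 := by positivity
  have m2 : |ω 2| * σ ≤ 6 * s ^ 2 := by nlinarith [abs_nonneg (ω 2)]
  have b1 : ∀ {t y : ℝ}, |t| ≤ 1 → |t * y| ≤ |y| := fun ht => by
    rw [abs_mul]; exact mul_le_of_le_one_left (abs_nonneg _) ht
  have hη2 : |η ^ 2 / 2| ≤ 1 := by
    rw [abs_div, abs_pow]; norm_num
    have := pow_le_one₀ (n := 2) (abs_nonneg _) hη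
    rw [sq_abs] at this; linarith
  have hζ2 : |ζ ^ 2 / 2| ≤ 1 := by
    rw [abs_div, abs_pow]; norm_num
    have := pow_le_one₀ (n := 2) (abs_nonneg _) hζ
    rw [sq_abs] at this; linarith
  have hζ3 : |1 - ζ ^ 2 / 2| ≤ 1 := by
    have := abs_le.1 hζ2
    rw [abs_le]; constructor <;> nlinarith [sq_nonneg ζ]
  have m0 : |ω 0| * σ ≤ 40 * s ^ 2 := by
    have h : |ω 0| ≤ 6 * s ^ 2 + |ω 1| + |ω 2| := by
      have e : ω 0 = (ω 0 - η * ω 1 + η ^ 2 / 2 * ω 2) + η * ω 1 - η ^ 2 / 2 * ω 2 := by ring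
      rw [e]
      refine (abs_sub _ _).trans ?_
      refine add_le_add ((abs_add_le _ _).trans (add_le_add w0 (b1 hη))) (b1 hη2)
    nlinarith
  have yc : |inner ℝ (core ζ) ω| * σ ≤ 74 * s ^ 2 := by
    rw [inner_core]
    have h : |ζ ^ 2 / 2 * ω 0 + ζ * ω 1 + ω 2| ≤ |ω 0| + |ω 1| + |ω 2| :=
      (abs_add_three _ _ _).trans (add_le_add (add_le_add (b1 hζ2) (b1 hζ)) le_rfl)
    nlinarith
  have yt : |inner ℝ (tangent ζ) ω| * σ ≤ 74 * s ^ 2 := by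
    rw [inner_tangent]
    have h : |ζ * ω 0 + (1 - ζ ^ 2 / 2) * ω 1 - ζ * ω 2| ≤ |ω 0| + |ω 1| + |ω 2| :=
      (abs_sub _ _).trans (add_le_add ((abs_add_le _ _).trans (add_le_add (b1 hζ) (b1 hζ3))) (b1 hζ))
    nlinarith
  have yn : |inner ℝ (normal ζ) ω| ≤ 248 * s ^ 2 := by
    rw [inner_normal]
    -- Expanding about `η` gains a factor `σ`: the main error is `|η - ζ| |ω 1| ≤ 8 σ |ω 1| ≤ 224 s
    -- ^ 2`.
    have e : ω 0 - ζ * ω 1 + ζ ^ 2 / 2 * ω 2 = (ω 0 - η * ω 1 + η ^ 2 / 2 * ω 2) +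
        (η - ζ) * ω 1 + (ζ ^ 2 / 2 - η ^ 2 / 2) * ω 2 := by ring
    rw [e]
    have h1 : |(η - ζ) * ω 1| ≤ 224 * s ^ 2 := by
      rw [abs_mul]
      nlinarith [abs_nonneg (ω 1)]
    have h2 : |(ζ ^ 2 / 2 - η ^ 2 / 2) * ω 2| ≤ 12 * s ^ 2 := by
      rw [abs_mul]
      have := (abs_sub (ζ ^ 2 / 2) (η ^ 2 / 2)).trans (add_le_add hζ2 hη2)
      nlinarith [abs_nonneg (ω 2)]
    refine (abs_add_three _ _ _).trans ?_
    linarith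
  exact ⟨yc, yt, yn⟩

/-- Duality in the frame at `ζ`: the box has sides about `K σ ^ 2`, `K`, `K σ` along core, normal
and tangent, and `ω` has components `O(s ^ 2 / σ)`, `O(s ^ 2)`, `O(s ^ 2 / σ)`. With `K s ^ 2 = 1`
the constants sum to `74 + 248 + 74 ≤ 400`. -/
theorem abs_inner_le_of_mem_box {K c : ℝ} (hs : 0 < s) (hsσ : s ≤ σ) (hσ1 : σ ≤ 1) (hc : 0 ≤ c)
    (hK : K * s ^ 2 = 1) (hη : |η| ≤ 1) (hζ : |ζ| ≤ 1) (hηζ : |η - ζ| ≤ 8 * σ) {ω x : E3}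
    (hω : ω ∈ diffBox s η) (hω1 : |ω 1| * σ ≤ 28 * s ^ 2) (hx : x ∈ box (c * K) σ ζ) :
    |inner ℝ x ω| ≤ 400 * c := by
  obtain ⟨x1, x2, x3⟩ := hx
  obtain ⟨yc, yt, yn⟩ := frame_le_of_mem_diffBox hs hsσ hσ1 hη hζ hηζ hω hω1
  have hσ : 0 < σ := hs.trans_le hsσ
  have hK0 : 0 ≤ K := by
    by_contra! hneg
    nlinarith [sq_nonneg s]
  have hinner : |inner ℝ x ω| ≤ _ := abs_inner_le_frame ζ x ω
  have ha1 := abs_nonneg (inner ℝ (core ζ) ω)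
  have ha2 := abs_nonneg (inner ℝ (normal ζ) ω)
  have ha3 := abs_nonneg (inner ℝ (tangent ζ) ω)
  generalize |inner ℝ (core ζ) ω| = a1 at *
  generalize |inner ℝ (normal ζ) ω| = a2 at *
  generalize |inner ℝ (tangent ζ) ω| = a3 at *
  have hcK : 0 ≤ c * K := mul_nonneg hc hK0
  have hKs : c * K * s ^ 2 = c := by rw [mul_assoc, hK, mul_one]
  have p1 : |inner ℝ (core ζ) x| * a1 ≤ 74 * c := by
    calc _ ≤ c * K * σ ^ 2 * a1 := by gcongr
      _ = c * K * σ * (a1 * σ) := by ring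
      _ ≤ c * K * 1 * (74 * s ^ 2) := by gcongr
      _ = 74 * (c * K * s ^ 2) := by ring
      _ = 74 * c := by rw [hKs]
  have p2 : |inner ℝ (normal ζ) x| * a2 ≤ 248 * c := by
    calc _ ≤ c * K * (248 * s ^ 2) := by gcongr
      _ = 248 * (c * K * s ^ 2) := by ring
      _ = 248 * c := by rw [hKs]
  have p3 : |inner ℝ (tangent ζ) x| * a3 ≤ 74 * c := by
    calc _ ≤ c * K * σ * a3 := by gcongr
      _ = c * K * (a3 * σ) := by ring
      _ ≤ c * K * (74 * s ^ 2) := by gcongr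
      _ = 74 * (c * K * s ^ 2) := by ring
      _ = 74 * c := by rw [hKs]
  linarith

/-! ### The two main estimates for Schwartz functions -/

theorem measurable_enorm_sq (f : 𝓢(E3, ℂ)) : Measurable fun x => ‖f x‖ₑ ^ 2 :=
  f.continuous.enorm.measurable.pow_const 2

/-- The `L⁴` square function estimate for sums over groups of sectors. -/
theorem lintegral_sq_sum_groups_le {s : ℝ} {D Z : Finset ℝ} {A : ℝ → ℝ} (hs : 0 < s) (hs1 : s ≤ 1)
    (hsep : ∀ x ∈ D, ∀ y ∈ D, x ≠ y → s ≤ |x - y|) (hD : ∀ x ∈ D, |x| ≤ 1)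
    (hA : ∀ η ∈ D, A η ∈ Z) (g : ℝ → 𝓢(E3, ℂ))
    (hg : ∀ η ∈ D, ∀ ξ, 𝓕 (g η) ξ ≠ 0 → ξ ∈ fatSector s η) :
    ∫⁻ x, (∑ ζ ∈ Z, ‖∑ η ∈ D with A η = ζ, g η x‖ₑ ^ 2) ^ 2 ≤
      (62 ^ 2 : ℕ) * ∫⁻ x, (∑ η ∈ D, ‖g η x‖ₑ ^ 2) ^ 2 := by
  classical
  have hpair : ∀ ζ ζ', ∫⁻ x, ‖(∑ η ∈ D with A η = ζ, g η x) *
      ∑ η ∈ D with A η = ζ', g η x‖ₑ ^ 2 ≤ (62 ^ 2 : ℕ) *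
      ∫⁻ x, (∑ η ∈ D with A η = ζ, ‖g η x‖ₑ ^ 2) * ∑ η ∈ D with A η = ζ', ‖g η x‖ₑ ^ 2 := by
    intro ζ ζ'
    -- The products carry no conjugate, so their frequencies lie in sums `θ + θ'`; differences would
    -- pile up at the origin when `θ = θ'`.
    have h := lintegral_enorm_sum_sq_le
      ({η ∈ D | A η = ζ} ×ˢ {η ∈ D | A η = ζ'}) (fun p => schwartzMul (g p.1) (g p.2)) (62 ^ 2)
      fun ξ => card_pairs_le hs hs1 hsep hD ξ _ fun p hp => by
        simp only [Finset.mem_filter, Finset.mem_product] at hp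
        obtain ⟨⟨⟨h1, _⟩, h2, _⟩, h3⟩ := hp
        obtain ⟨α, β, hα, hβ, hαβ⟩ := exists_of_fourier_schwartzMul_ne_zero h3
        exact ⟨h1, h2, α, β, hg _ h1 α hα, hg _ h2 β hβ, hαβ⟩
    rw [← lintegral_finsetSum _ fun p _ => measurable_enorm_sq _] at h
    simp only [schwartzMul_apply, enorm_mul, mul_pow, Finset.sum_product] at h
    simpa only [Finset.sum_mul_sum, enorm_mul, mul_pow] using h
  have hmeas : ∀ ζ ζ', Measurable fun x => (∑ η ∈ D with A η = ζ, ‖g η x‖ₑ ^ 2) *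
      ∑ η ∈ D with A η = ζ', ‖g η x‖ₑ ^ 2 := fun ζ ζ' =>
    (Finset.measurable_fun_sum _ fun η _ => measurable_enorm_sq (g η)).mul
      (Finset.measurable_fun_sum _ fun η _ => measurable_enorm_sq (g η))
  have hmeas2 : ∀ ζ ζ', Measurable fun x => ‖(∑ η ∈ D with A η = ζ, g η x) *
      ∑ η ∈ D with A η = ζ', g η x‖ₑ ^ 2 := fun ζ ζ' => by
    refine Measurable.pow_const (Continuous.measurable ?_) 2
    exact ((continuous_finsetSum _ fun η _ => (g η).continuous).mul
      (continuous_finsetSum _ fun η _ => (g η).continuous)).enorm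
  calc ∫⁻ x, (∑ ζ ∈ Z, ‖∑ η ∈ D with A η = ζ, g η x‖ₑ ^ 2) ^ 2
      = ∑ ζ ∈ Z, ∑ ζ' ∈ Z, ∫⁻ x, ‖(∑ η ∈ D with A η = ζ, g η x) *
          ∑ η ∈ D with A η = ζ', g η x‖ₑ ^ 2 := by
        simp_rw [← lintegral_finsetSum Z fun ζ' _ => hmeas2 _ ζ']
        rw [← lintegral_finsetSum Z fun ζ _ => Finset.measurable_fun_sum _ fun ζ' _ => hmeas2 ζ ζ']
        refine lintegral_congr fun x => ?_
        rw [sq, Finset.sum_mul_sum]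
        simp only [enorm_mul, mul_pow]
    _ ≤ ∑ ζ ∈ Z, ∑ ζ' ∈ Z, (62 ^ 2 : ℕ) * ∫⁻ x, (∑ η ∈ D with A η = ζ, ‖g η x‖ₑ ^ 2) *
          ∑ η ∈ D with A η = ζ', ‖g η x‖ₑ ^ 2 :=
        Finset.sum_le_sum fun ζ _ => Finset.sum_le_sum fun ζ' _ => hpair ζ ζ'
    _ = (62 ^ 2 : ℕ) * ∫⁻ x, (∑ η ∈ D, ‖g η x‖ₑ ^ 2) ^ 2 := by
        simp_rw [← Finset.mul_sum, ← lintegral_finsetSum Z fun ζ' _ => hmeas _ ζ']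
        rw [← lintegral_finsetSum Z fun ζ _ => Finset.measurable_fun_sum _ fun ζ' _ => hmeas ζ ζ']
        congr 1
        refine lintegral_congr fun x => ?_
        rw [← Finset.sum_mul_sum, Finset.sum_fiberwise_of_maps_to hA, sq]

/-- If the phases of all frequencies in `A` are small on a multiple `c` of the box `U`, then the
`L²` mass of a function on these frequencies is controlled by its averages on a tiling by `U`. -/
theorem setLIntegral_fourier_le {ρ s η c : ℝ} (hρ : 0 < ρ) (hs : 0 < s) (hc : 0 < c) (hc1 : c ≤ 1)
    {T : Set E3} (hT : IsTiling (box ρ s η) T) (G : 𝓢(E3, ℂ)) {A : Set E3} (hA : MeasurableSet A)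
    (hphase : ∀ ω ∈ A, 𝓕 G ω ≠ 0 → ∀ x ∈ box (c * ρ) s η, 2 * Real.pi * |inner ℝ x ω| ≤ 1 / 2) :
    ∫⁻ ω in A, ‖𝓕 G ω‖ₑ ^ 2 ≤ 216 * ENNReal.ofReal (c ^ 3 / 16)⁻¹ ^ 2 *
      ∑' v : T, (volume ((v : E3) +ᵥ box ρ s η))⁻¹ *
        (∫⁻ x in (v : E3) +ᵥ box ρ s η, ‖G x‖ₑ) ^ 2 := by
  obtain ⟨φ, hφs, hφc, hφ0, hφ1, hφU, hφI⟩ := exists_box_bump hρ hs η hc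
  set U := box ρ s η with hU
  have hcU : box (c * ρ) s η ⊆ U := by
    intro x hx
    have h1 : c * ρ ≤ ρ := by nlinarith
    exact ⟨hx.1.trans (by gcongr), hx.2.1.trans h1, hx.2.2.trans (by gcongr)⟩
  have hφi : Integrable φ := hφs.continuous.integrable_of_hasCompactSupport hφc
  let Φ : 𝓢(E3, ℂ) := (hφc.comp_left Complex.ofReal_zero).toSchwartzMap
    (Complex.ofRealCLM.contDiff.comp hφs)
  have hΦ : (Φ : E3 → ℂ) = fun x => (φ x : ℂ) := rfl
  set I := ∫ x, φ x with hI
  have hI0 : 0 ≤ I := integral_nonneg hφ0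
  have hvt : volume U ≠ ⊤ := volume_box_ne_top
  have hv0 : volume U ≠ 0 := volume_box_ne_zero hρ hs
  set κ := ENNReal.ofReal (c ^ 3 / 16) with hκ
  have hκ0 : κ ≠ 0 := by rw [hκ]; simp only [ne_eq, ENNReal.ofReal_eq_zero, not_le]; positivity
  -- The bump has integral `I ≥ (c / 2) ^ 3 |U|`, and half of it survives the small phases: `16 = 2
  -- * 2 ^ 3`.
  have hκI : κ * volume U ≤ ENNReal.ofReal (I / 2) := by
    rw [hκ, ← ENNReal.ofReal_toReal hvt, ← ENNReal.ofReal_mul (by positivity)]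
    refine ENNReal.ofReal_le_ofReal ?_
    change c ^ 3 / 16 * volume.real U ≤ I / 2
    nlinarith
  have hconv : ∀ x, SchwartzMap.convolution (ContinuousLinearMap.mul ℂ ℂ) Φ G x =
      ∫ t, Φ t * G (x - t) := fun x => by
    rw [SchwartzMap.convolution_apply, convolution]; rfl
  -- Since `0 ≤ φ ≤ 1` is supported in the symmetric box `U`, convolution with `φ` is dominated by
  -- integration over `x + U`.
  have hbound : ∀ x : E3, ‖SchwartzMap.convolution (ContinuousLinearMap.mul ℂ ℂ) Φ G x‖ₑ ≤
      ∫⁻ t in x +ᵥ U, ‖G t‖ₑ := by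
    intro x
    rw [hconv]
    refine (enorm_integral_le_lintegral_enorm _).trans ?_
    rw [← lintegral_sub_left_eq_self _ x,
      ← lintegral_indicator (isClosed_box.measurableSet.const_vadd x)]
    refine lintegral_mono fun t => ?_
    simp only [sub_sub_cancel, enorm_mul]
    by_cases ht : φ (x - t) = 0
    · simp [hΦ, ht]
    · have hmem : t ∈ x +ᵥ U := by
        refine ⟨-(x - t), neg_mem_box (hcU (hφU _ ht)), ?_⟩
        simp
      rw [Set.indicator_of_mem hmem]
      refine mul_le_of_le_one_left' ?_
      rw [hΦ, ← ofReal_norm, Complex.norm_real, Real.norm_eq_abs, abs_of_nonneg (hφ0 _)]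
      exact ENNReal.ofReal_le_one.2 (hφ1 _)
  -- Wherever `𝓕 G ω ≠ 0` on `A`, the phases on the support of `φ` are at most `1 / 2`, so `|𝓕 Φ ω|
  -- ≥ I / 2`: convolving with `Φ` loses only a constant.
  have hlow : ∀ ω ∈ A, ENNReal.ofReal (I / 2) ^ 2 * ‖𝓕 G ω‖ₑ ^ 2 ≤
      ‖𝓕 (SchwartzMap.convolution (ContinuousLinearMap.mul ℂ ℂ) Φ G) ω‖ₑ ^ 2 := by
    intro ω hω
    rw [SchwartzMap.fourier_convolution, SchwartzMap.pairing_apply_apply,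
      ContinuousLinearMap.mul_apply', enorm_mul, mul_pow]
    by_cases hG : 𝓕 G ω = 0
    · simp [hG]
    gcongr
    have h1 := norm_fourier_sub_integral_le hφi hφ0 (ω := ω) (c := 1 / 2 / (2 * Real.pi))
      fun x hx => by
        rw [le_div_iff₀ Real.two_pi_pos, mul_comm]
        exact hphase ω hω hG x (hφU x hx)
    rw [mul_div_cancel₀ _ Real.two_pi_pos.ne', ← hI] at h1
    rw [← ofReal_norm]
    refine ENNReal.ofReal_le_ofReal ?_
    have h2 : ‖((I : ℝ) : ℂ)‖ = I := by rw [Complex.norm_real, Real.norm_eq_abs, abs_of_nonneg hI0]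
    have h3 := norm_sub_norm_le ((I : ℝ) : ℂ) (𝓕 (fun x => (φ x : ℂ)) ω)
    rw [norm_sub_rev] at h3
    have h4 : 𝓕 Φ ω = 𝓕 (fun x => (φ x : ℂ)) ω := by rw [SchwartzMap.fourier_coe, hΦ]
    rw [h4]
    linarith
  have hmain : (κ * volume U) ^ 2 * ∫⁻ ω in A, ‖𝓕 G ω‖ₑ ^ 2 ≤
      216 * volume U * ∑' v : T, (∫⁻ t in (v : E3) +ᵥ U, ‖G t‖ₑ) ^ 2 := by
    calc (κ * volume U) ^ 2 * ∫⁻ ω in A, ‖𝓕 G ω‖ₑ ^ 2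
        ≤ ENNReal.ofReal (I / 2) ^ 2 * ∫⁻ ω in A, ‖𝓕 G ω‖ₑ ^ 2 := by gcongr
      _ = ∫⁻ ω in A, ENNReal.ofReal (I / 2) ^ 2 * ‖𝓕 G ω‖ₑ ^ 2 :=
          (lintegral_const_mul' _ _ (by simp)).symm
      _ ≤ ∫⁻ ω in A, ‖𝓕 (SchwartzMap.convolution (ContinuousLinearMap.mul ℂ ℂ) Φ G) ω‖ₑ ^ 2 :=
          setLIntegral_mono' hA hlow
      _ ≤ ∫⁻ ω, ‖𝓕 (SchwartzMap.convolution (ContinuousLinearMap.mul ℂ ℂ) Φ G) ω‖ₑ ^ 2 :=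
          setLIntegral_le_lintegral _ _
      _ ≤ ∫⁻ x : E3, (∫⁻ t in x +ᵥ U, ‖G t‖ₑ) ^ 2 := by
          rw [lintegral_enorm_sq_fourier]
          exact lintegral_mono fun x => by gcongr; exact hbound x
      _ ≤ _ := hT.lintegral_sq_le convex_box (fun x => neg_mem_box) isClosed_box.measurableSet
          hv0 hvt _
  have hκt : κ ≠ ⊤ := ENNReal.ofReal_ne_top
  have hκinv : ENNReal.ofReal (c ^ 3 / 16)⁻¹ = κ⁻¹ := ENNReal.ofReal_inv_of_pos (by positivity)
  simp only [measure_vadd]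
  rw [ENNReal.tsum_mul_left, hκinv]
  have hne : κ * volume U ≠ 0 := mul_ne_zero hκ0 hv0
  have hnt : κ * volume U ≠ ⊤ := ENNReal.mul_ne_top hκt hvt
  have h5 := mul_le_mul_right hmain ((κ * volume U) ^ 2)⁻¹
  rw [← mul_assoc, ENNReal.inv_mul_cancel (pow_ne_zero _ hne) (ENNReal.pow_ne_top hnt),
    one_mul] at h5
  refine h5.trans (le_of_eq ?_)
  rw [ENNReal.inv_pow, ENNReal.mul_inv (Or.inl hκ0) (Or.inl hκt)]
  calc _ = 216 * κ⁻¹ ^ 2 * ((volume U)⁻¹ * ((volume U)⁻¹ * volume U *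
        ∑' v : T, (∫⁻ t in (v : E3) +ᵥ U, ‖G t‖ₑ) ^ 2)) := by ring
    _ = _ := by rw [ENNReal.inv_mul_cancel hv0 hvt, one_mul]

/-! ### Dyadic slabs and the Kakeya-type estimate -/

/-- The frequencies whose second coordinate has size about `s ^ 2 * 2 ^ k`. -/
def slab (s : ℝ) (k : ℕ) : Set E3 :=
  {ω | |ω 1| * 2⁻¹ ^ k ≤ 28 * s ^ 2 ∧ (k = 0 ∨ 14 * s ^ 2 < |ω 1| * 2⁻¹ ^ k)}

theorem measurableSet_slab (s : ℝ) (k : ℕ) : MeasurableSet (slab s k) := by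
  have h : Measurable fun ω : E3 => |ω 1| * (2⁻¹ : ℝ) ^ k := by
    refine Continuous.measurable ?_
    fun_prop
  exact (measurableSet_le h measurable_const).inter
    ((MeasurableSet.const _).union (measurableSet_lt measurable_const h))

/-- The least `k` satisfying the upper bound also satisfies the lower one, by minimality. For `k >
0`, `14 s ^ 2 < |ω₂| 2⁻ᵏ ≤ 14 s 2⁻ᵏ` then keeps the scale above `s`. -/
theorem exists_mem_slab {s : ℝ} (hs : 0 < s) (hs1 : s ≤ 1) {ω : E3} (hω : |ω 1| ≤ 14 * s) :
    ∃ k : ℕ, s ≤ 2⁻¹ ^ k ∧ ω ∈ slab s k := by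
  have hex : ∃ k : ℕ, |ω 1| * 2⁻¹ ^ k ≤ 28 * s ^ 2 := by
    have h1 : Filter.Tendsto (fun k : ℕ => |ω 1| * (2⁻¹ : ℝ) ^ k) Filter.atTop (nhds (|ω 1| * 0)) :=
      (tendsto_pow_atTop_nhds_zero_of_lt_one (by norm_num) (by norm_num)).const_mul _
    rw [mul_zero] at h1
    exact (h1.eventually_le_const (by positivity)).exists
  classical
  have hk := Nat.find_spec hex
  have hmin := fun m => Nat.find_min hex (m := m)
  generalize Nat.find hex = k at hk hmin
  rcases k with _ | k
  · exact ⟨0, by simpa using hs1, hk, Or.inl rfl⟩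
  · have h1 := not_le.1 (hmin k (Nat.lt_succ_self k))
    have h2 : (2⁻¹ : ℝ) ^ (k + 1) = 2⁻¹ ^ k / 2 := by rw [pow_succ]; ring
    have h3 : 14 * s ^ 2 < |ω 1| * 2⁻¹ ^ (k + 1) := by rw [h2]; linarith
    refine ⟨k + 1, ?_, hk, Or.inr h3⟩
    have h4 : 0 < (2⁻¹ : ℝ) ^ (k + 1) := by positivity
    by_contra! hlt
    nlinarith [abs_nonneg (ω 1)]

theorem inv_two_pow_eq_one_or_le (k : ℕ) : (2⁻¹ : ℝ) ^ k = 1 ∨ (2⁻¹ : ℝ) ^ k ≤ 1 / 2 := by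
  rcases k with _ | k
  · simp
  · right
    rw [pow_succ]
    have : (2⁻¹ : ℝ) ^ k ≤ 1 := pow_le_one₀ (by norm_num) (by norm_num)
    linarith

theorem inv_sqrt_bounds {K : ℝ} (hK : 10 ≤ K) :
    0 < (√K)⁻¹ ∧ (√K)⁻¹ ≤ 1 / 2 ∧ ((√K)⁻¹) ^ 2 ≤ 1 / 10 ∧ 1 / K = ((√K)⁻¹) ^ 2 ∧
      K * ((√K)⁻¹) ^ 2 = 1 := by
  have hK0 : 0 < K := by linarith
  have h1 : ((√K)⁻¹) ^ 2 = 1 / K := by rw [inv_pow, Real.sq_sqrt hK0.le, one_div]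
  have h2 : 1 / K ≤ 1 / 10 := one_div_le_one_div_of_le (by norm_num) hK
  have h3 : 0 < (√K)⁻¹ := inv_pos.2 (Real.sqrt_pos.2 hK0)
  refine ⟨h3, ?_, h1 ▸ h2, h1.symm, ?_⟩
  · nlinarith
  · rw [h1]; field_simp

/-- The Kakeya-type estimate for the square function: decompose the frequency space into slabs, and
use that on the slab of scale `σ` only boundedly many sectors of aperture `σ` contribute. -/
theorem lintegral_sq_sum_le_boxSum {K : ℝ} (hK : 10 ≤ K) {A : ℝ → ℝ → ℝ} {T : ℝ → ℝ → Set E3}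
    (hA : IsAssignment K K A)
    (hT : ∀ s, (√K)⁻¹ ≤ s → s ≤ 1 → ∀ ζ ∈ directions s, IsTiling (box K s ζ) (T s ζ))
    (g : ℝ → 𝓢(E3, ℂ)) (hg : ∀ η ∈ directions (√K)⁻¹, ∀ ξ, 𝓕 (g η) ξ ≠ 0 →
      ξ ∈ fatSector (√K)⁻¹ η) :
    ∫⁻ x, (∑ η ∈ directions (√K)⁻¹, ‖g η x‖ₑ ^ 2) ^ 2 ≤
      37 * (216 * ENNReal.ofReal ((1 / 10000) ^ 3 / 16)⁻¹ ^ 2) *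
        boxSum K A (fun η => g η) T := by
  classical
  obtain ⟨hs, hs2, hs10, hsK, hKs⟩ := inv_sqrt_bounds hK
  set s := (√K)⁻¹ with hsdef
  have hs1 : s ≤ 1 := by linarith
  -- `h η = |g η|²`, as a Schwartz function; its frequencies are differences of points of one
  -- sector.
  let h : ℝ → 𝓢(E3, ℂ) := fun η => schwartzMul (g η) (schwartzConj (g η))
  have hh : ∀ η x, h η x = ((‖g η x‖ ^ 2 : ℝ) : ℂ) := fun η x => by
    simp [h, Complex.mul_conj, Complex.normSq_eq_norm_sq]
  have hsum : ∀ (D : Finset ℝ) x, ‖(∑ η ∈ D, h η) x‖ₑ = ∑ η ∈ D, ‖g η x‖ₑ ^ 2 := by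
    intro D x
    have h1 : (∑ η ∈ D, h η) x = ((∑ η ∈ D, ‖g η x‖ ^ 2 : ℝ) : ℂ) := by
      simp [hh]
    rw [h1, ← ofReal_norm, Complex.norm_real, Real.norm_eq_abs,
      abs_of_nonneg (Finset.sum_nonneg fun _ _ => by positivity),
      ENNReal.ofReal_sum_of_nonneg fun _ _ => by positivity]
    refine Finset.sum_congr rfl fun η _ => ?_
    rw [ENNReal.ofReal_pow (norm_nonneg _), ofReal_norm]
  have hsupp : ∀ η ∈ directions s, ∀ ω, 𝓕 (h η) ω ≠ 0 → ω ∈ diffBox s η := by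
    intro η hη ω hω
    obtain ⟨α, β, hα, hβ, rfl⟩ := exists_of_fourier_schwartzMul_ne_zero hω
    rw [fourier_schwartzConj] at hβ
    have hβ' : 𝓕 (g η) (-β) ≠ 0 := fun h0 => hβ (by rw [h0, map_zero])
    simpa using sub_mem_diffBox (hg η hη α hα) (hg η hη (-β) hβ')
  have hη1 : ∀ η ∈ directions s, |η| ≤ 1 := fun η => abs_le_one_of_mem_directions hs hs1
  have hgsupp : ∀ (D : Finset ℝ) ω, 𝓕 (∑ η ∈ D, h η) ω ≠ 0 → ∃ η ∈ D, 𝓕 (h η) ω ≠ 0 := by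
    intro D ω hω
    rw [fourier_sum_apply] at hω
    exact Finset.exists_ne_zero_of_sum_ne_zero hω
  let κ : Type := {k : ℕ // s ≤ (2⁻¹ : ℝ) ^ k}
  let σ : κ → ℝ := fun k => (2⁻¹ : ℝ) ^ (k : ℕ)
  have hσ0 : ∀ k, 0 < σ k := fun k => by positivity
  have hσ1 : ∀ k, σ k ≤ 1 := fun k => pow_le_one₀ (by norm_num) (by norm_num)
  let G : κ → ℝ → 𝓢(E3, ℂ) := fun k ζ => ∑ η ∈ children K A (σ k) ζ, h η
  have hchild : ∀ k ζ η, η ∈ children K A (σ k) ζ →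
      η ∈ directions s ∧ |η - ζ| ≤ 8 * σ k := by
    intro k ζ η hη
    obtain ⟨h1, h2⟩ := Finset.mem_filter.1 hη
    refine ⟨h1, ?_⟩
    have h3 := (hA (σ k) k.2 (hσ1 k) η h1).2
    rw [h2] at h3
    exact abs_sub_le_of_sectors_meet hs hs10 k.2 hsK h3
  have hcount : ∀ (k : κ) (ω : E3), ω ∈ slab s k →
      {ζ ∈ directions (σ k) | 𝓕 (G k ζ) ω ≠ 0}.card ≤ 37 := by
    intro k ω hω
    rcases Finset.eq_empty_or_nonempty {ζ ∈ directions (σ k) | 𝓕 (G k ζ) ω ≠ 0} with he | ⟨ζ₀, hζ₀⟩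
    · rw [he]; simp
    -- `18 = 8 + 2 + 8`: from `ζ` to a child `η`, from `η` to a child `η₀` of `ζ₀`, and from `η₀` to
    -- `ζ₀`. Hence `37 = 2 * 18 + 1`.
    refine card_le_of_separated (L := 18) (p := ζ₀) (hσ0 k) (fun x hx y hy =>
      directions_separated (hσ0 k) (inv_two_pow_eq_one_or_le k) x
        (Finset.filter_subset _ _ hx) y (Finset.filter_subset _ _ hy)) fun ζ hζ => ?_
    obtain ⟨hζd, hζ⟩ := Finset.mem_filter.1 hζ
    obtain ⟨hζd₀, hζ₀⟩ := Finset.mem_filter.1 hζ₀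
    -- The lowest slab has no lower bound on `|ω 1|`, but at aperture `1` there is only one sector.
    rcases hω.2 with h0 | hlow
    · have h1 : σ k = 1 := by simp [σ, h0]
      rw [h1, directions_one, Finset.mem_singleton] at hζd hζd₀
      rw [hζd, hζd₀, h1]; norm_num
    · obtain ⟨η, hη, hηω⟩ := hgsupp _ _ hζ
      obtain ⟨η₀, hη₀, hηω₀⟩ := hgsupp _ _ hζ₀
      obtain ⟨c1, c2⟩ := hchild k ζ η hη
      obtain ⟨c3, c4⟩ := hchild k ζ₀ η₀ hη₀
      have h1 := abs_sub_le_of_mem_diffBox (hσ0 k) (hη1 η c1) (hη1 η₀ c3) (hsupp η c1 ω hηω)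
        (hsupp η₀ c3 ω hηω₀) hlow
      push_cast
      rw [abs_le] at *
      constructor <;> linarith
  -- One slab containing `ω` suffices: the sum is regrouped by the sectors of that slab's scale, of
  -- which at most 37 are nonzero at `ω`.
  have hpt : ∀ ω, ‖𝓕 (∑ η ∈ directions s, h η) ω‖ₑ ^ 2 ≤
      ∑' k : κ, (slab s k).indicator
        (fun ω => 37 * ∑ ζ ∈ directions (σ k), ‖𝓕 (G k ζ) ω‖ₑ ^ 2) ω := by
    intro ω
    by_cases h0 : 𝓕 (∑ η ∈ directions s, h η) ω = 0
    · rw [h0]; simp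
    obtain ⟨η, hη, hω⟩ := hgsupp _ _ h0
    have hωd := hsupp η hη ω hω
    have hω1 : |ω 1| ≤ 14 * s := by
      obtain ⟨w1, w2, _⟩ := hωd
      have h1 : |η * ω 2| ≤ 6 * s ^ 2 := by
        rw [abs_mul]; exact (mul_le_of_le_one_left (abs_nonneg _) (hη1 η hη)).trans w1
      rw [abs_le] at *
      constructor <;> nlinarith
    obtain ⟨k, hk, hkω⟩ := exists_mem_slab hs hs1 hω1
    refine le_trans ?_ (ENNReal.le_tsum (⟨k, hk⟩ : κ))
    rw [Set.indicator_of_mem hkω]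
    have hdec : 𝓕 (∑ η ∈ directions s, h η) ω =
        ∑ ζ ∈ directions (σ ⟨k, hk⟩), 𝓕 (G ⟨k, hk⟩ ζ) ω := by
      simp only [G, fourier_sum_apply]
      exact (Finset.sum_fiberwise_of_maps_to
        (fun η hη => (hA (σ ⟨k, hk⟩) hk (hσ1 _) η hη).1) _).symm
    rw [hdec]
    refine (enorm_sum_sq_le _ _).trans ?_
    gcongr
    exact_mod_cast hcount ⟨k, hk⟩ ω hkω
  have hbox : ∀ k : κ, ∀ ζ ∈ directions (σ k), ∫⁻ ω in slab s k, ‖𝓕 (G k ζ) ω‖ₑ ^ 2 ≤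
      216 * ENNReal.ofReal ((1 / 10000) ^ 3 / 16)⁻¹ ^ 2 *
      ∑' v : T (σ k) ζ, (volume ((v : E3) +ᵥ box K (σ k) ζ))⁻¹ *
        (∫⁻ x in (v : E3) +ᵥ box K (σ k) ζ,
          ∑ η ∈ children K A (σ k) ζ, ‖g η x‖ₑ ^ 2) ^ 2 := by
    intro k ζ hζ
    have hphase : ∀ ω ∈ slab s k, 𝓕 (G k ζ) ω ≠ 0 → ∀ x ∈ box (1 / 10000 * K) (σ k) ζ,
        2 * Real.pi * |inner ℝ x ω| ≤ 1 / 2 := by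
      intro ω hω hne x hx
      obtain ⟨η, hη, hηω⟩ := hgsupp _ _ hne
      obtain ⟨c1, c2⟩ := hchild k ζ η hη
      have h1 := abs_inner_le_of_mem_box hs k.2 (hσ1 k) (by norm_num) hKs (hη1 η c1)
        (abs_le_one_of_mem_directions (hσ0 k) (hσ1 k) hζ) c2 (hsupp η c1 ω hηω) hω.1 hx
      -- `2 π * 400 / 10000 < 1 / 2` explains the dilation factor `1 / 10000`.
      nlinarith [Real.pi_pos, Real.pi_lt_four]
    have h1 := setLIntegral_fourier_le (by linarith) (hσ0 k) (by norm_num) (by norm_num)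
      (hT (σ k) k.2 (hσ1 k) ζ hζ) (G k ζ) (measurableSet_slab s k) hphase
    simpa only [G, hsum] using h1
  calc ∫⁻ x, (∑ η ∈ directions s, ‖g η x‖ₑ ^ 2) ^ 2
      = ∫⁻ ω, ‖𝓕 (∑ η ∈ directions s, h η) ω‖ₑ ^ 2 := by
        rw [lintegral_enorm_sq_fourier]
        simp only [hsum]
    _ ≤ ∫⁻ ω, ∑' k : κ, (slab s k).indicator
        (fun ω => 37 * ∑ ζ ∈ directions (σ k), ‖𝓕 (G k ζ) ω‖ₑ ^ 2) ω := lintegral_mono hpt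
    _ = ∑' k : κ, 37 * ∑ ζ ∈ directions (σ k), ∫⁻ ω in slab s k, ‖𝓕 (G k ζ) ω‖ₑ ^ 2 := by
        have hm : ∀ k : κ, Measurable fun ω =>
            37 * ∑ ζ ∈ directions (σ k), ‖𝓕 (G k ζ) ω‖ₑ ^ 2 := fun k =>
          (Finset.measurable_fun_sum _ fun ζ _ => measurable_enorm_sq _).const_mul _
        rw [lintegral_tsum fun k => ((hm k).indicator (measurableSet_slab s k)).aemeasurable]
        refine tsum_congr fun k => ?_
        rw [lintegral_indicator (measurableSet_slab s k), lintegral_const_mul' _ _ (by simp),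
          lintegral_finsetSum _ fun ζ _ => measurable_enorm_sq _]
    _ ≤ ∑' k : κ, 37 * ∑ ζ ∈ directions (σ k),
          216 * ENNReal.ofReal ((1 / 10000) ^ 3 / 16)⁻¹ ^ 2 *
          ∑' v : T (σ k) ζ, (volume ((v : E3) +ᵥ box K (σ k) ζ))⁻¹ *
            (∫⁻ x in (v : E3) +ᵥ box K (σ k) ζ,
              ∑ η ∈ children K A (σ k) ζ, ‖g η x‖ₑ ^ 2) ^ 2 := by
        gcongr with k ζ hζ
        exact hbox k ζ hζ
    _ = _ := by
        simp_rw [← Finset.mul_sum, ← mul_assoc]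
        rw [ENNReal.tsum_mul_left, boxSum]

/-! ### Removal of the Schwartz assumption and conclusion -/

theorem boxSum_mono {K : ℝ} {A : ℝ → ℝ → ℝ} {F F' : ℝ → E3 → ℂ} (T : ℝ → ℝ → Set E3)
    (h : ∀ η ∈ directions (√K)⁻¹, ∀ x, ‖F η x‖ₑ ≤ ‖F' η x‖ₑ) :
    boxSum K A F T ≤ boxSum K A F' T := by
  unfold boxSum
  gcongr with k ζ hζ v x η hη
  exact h η (Finset.filter_subset _ _ hη) x

/-- The estimates are applied to `F η * χ n` with cutoffs `χ n → 1`. As `|χ n| ≤ 1`, the right side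
is bounded by that of `F` uniformly in `n`, and Fatou's lemma passes to the limit on the left. -/
theorem lintegral_sq_sectorPiece_le_boxSum {K r : ℝ} (hK : 10 ≤ K) (hr : 1 ≤ r) (hrK : r ≤ K)
    {f : E3 → ℂ} {F : ℝ → E3 → ℂ} {A : ℝ → ℝ → ℝ} {T : ℝ → ℝ → Set E3}
    (hF : IsDecomposition K K f F) (hA : IsAssignment K K A)
    (hT : ∀ s, (√K)⁻¹ ≤ s → s ≤ 1 → ∀ ζ ∈ directions s, IsTiling (box K s ζ) (T s ζ)) :
    ∫⁻ x, (∑ ζ ∈ directions (√r)⁻¹, ‖sectorPiece K A F (√r)⁻¹ ζ x‖ₑ ^ 2) ^ 2 ≤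
      (62 ^ 2 : ℕ) * (37 * (216 * ENNReal.ofReal ((1 / 10000) ^ 3 / 16)⁻¹ ^ 2) *
        boxSum K A F T) := by
  obtain ⟨hs, hs2, hs10, hsK, hKs⟩ := inv_sqrt_bounds hK
  have hs1 : (√K)⁻¹ ≤ 1 := by linarith
  have hr1 : (√r)⁻¹ ≤ 1 := inv_le_one_of_one_le₀ (Real.one_le_sqrt.2 hr)
  have hrK' : (√K)⁻¹ ≤ (√r)⁻¹ :=
    inv_anti₀ (Real.sqrt_pos.2 (by linarith)) (Real.sqrt_le_sqrt hrK)
  have hη1 : ∀ η ∈ directions (√K)⁻¹, |η| ≤ 1 := fun η => abs_le_one_of_mem_directions hs hs1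
  -- Never larger than `s ^ 2 / 3`, so that Fourier supports stay in `fatSector`, yet tending to
  -- zero so that the cutoffs converge to `1`.
  set ε : ℕ → ℝ := fun n => ((√K)⁻¹) ^ 2 / 3 * (1 / ((n : ℝ) + 1)) with hε
  have hε0 : ∀ n, 0 < ε n := fun n => by positivity
  have hε1 : ∀ n, ε n ≤ ((√K)⁻¹) ^ 2 / 3 := fun n => by
    refine mul_le_of_le_one_right (by positivity) ?_
    rw [div_le_one (by positivity)]
    linarith [n.cast_nonneg (α := ℝ)]
  have hεlim : Filter.Tendsto ε Filter.atTop (nhds 0) := by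
    have := (tendsto_one_div_add_atTop_nhds_zero_nat (𝕜 := ℝ)).const_mul (((√K)⁻¹) ^ 2 / 3)
    rwa [mul_zero] at this
  choose χ hχ1 hχsupp hχlim using fun n => exists_schwartz_cutoff (hε0 n)
  have hex : ∀ n η, ∃ g : 𝓢(E3, ℂ), η ∈ directions (√K)⁻¹ → (∀ x, g x = F η x * χ n x) ∧
      ∀ ξ, 𝓕 g ξ ≠ 0 → ξ ∈ fatSector (√K)⁻¹ η := by
    intro n η
    by_cases hη : η ∈ directions (√K)⁻¹
    · obtain ⟨g, h1, h2⟩ := (hF.support_piece η hη).exists_schwartz_mul (χ n) (hχsupp n)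
      refine ⟨g, fun _ => ⟨h1, fun ξ hξ => ?_⟩⟩
      obtain ⟨ν, hν, hd⟩ := h2 ξ hξ
      exact mem_fatSector hs hs1 hsK (hη1 η hη) (hε1 n) hν hd
    · exact ⟨0, fun h => absurd h hη⟩
  choose g hg using hex
  have hbound : ∀ n, ∫⁻ x, (∑ ζ ∈ directions (√r)⁻¹,
      ‖∑ η ∈ directions (√K)⁻¹ with A (√r)⁻¹ η = ζ, g n η x‖ₑ ^ 2) ^ 2 ≤
      (62 ^ 2 : ℕ) * (37 * (216 * ENNReal.ofReal ((1 / 10000) ^ 3 / 16)⁻¹ ^ 2) *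
        boxSum K A F T) := by
    intro n
    refine (lintegral_sq_sum_groups_le hs hs1 (directions_separated hs (Or.inr hs2)) hη1
      (fun η hη => (hA _ hrK' hr1 η hη).1) (g n) fun η hη => (hg n η hη).2).trans ?_
    gcongr
    refine (lintegral_sq_sum_le_boxSum hK hA hT (g n) fun η hη => (hg n η hη).2).trans ?_
    gcongr
    refine boxSum_mono T fun η hη x => ?_
    rw [(hg n η hη).1, enorm_mul]
    refine mul_le_of_le_one_right' ?_
    rw [← ofReal_norm]
    exact ENNReal.ofReal_le_one.2 (hχ1 n x)
  have hχ : ∀ x, Filter.Tendsto (fun n => χ n x) Filter.atTop (nhds 1) := by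
    intro x
    rw [tendsto_iff_norm_sub_tendsto_zero]
    refine squeeze_zero (fun _ => norm_nonneg _) (fun n => hχlim n x) ?_
    simpa using (hεlim.mul_const ‖x‖).const_mul (2 * Real.pi)
  have hlim : ∀ x, Filter.Tendsto (fun n => (∑ ζ ∈ directions (√r)⁻¹,
      ‖∑ η ∈ directions (√K)⁻¹ with A (√r)⁻¹ η = ζ, g n η x‖ₑ ^ 2) ^ 2) Filter.atTop
      (nhds ((∑ ζ ∈ directions (√r)⁻¹, ‖sectorPiece K A F (√r)⁻¹ ζ x‖ₑ ^ 2) ^ 2)) := by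
    intro x
    refine ((ENNReal.continuous_pow 2).tendsto _).comp (tendsto_finsetSum _ fun ζ _ => ?_)
    refine ((ENNReal.continuous_pow 2).tendsto _).comp (Filter.Tendsto.enorm ?_)
    refine tendsto_finsetSum _ fun η hη => ?_
    simp_rw [fun n => (hg n η (Finset.mem_filter.1 hη).1).1 x]
    simpa using (hχ x).const_mul (F η x)
  calc ∫⁻ x, (∑ ζ ∈ directions (√r)⁻¹, ‖sectorPiece K A F (√r)⁻¹ ζ x‖ₑ ^ 2) ^ 2
      = ∫⁻ x, Filter.liminf (fun n => (∑ ζ ∈ directions (√r)⁻¹,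
          ‖∑ η ∈ directions (√K)⁻¹ with A (√r)⁻¹ η = ζ, g n η x‖ₑ ^ 2) ^ 2) Filter.atTop :=
        lintegral_congr fun x => (hlim x).liminf_eq.symm
    _ ≤ Filter.liminf (fun n => ∫⁻ x, (∑ ζ ∈ directions (√r)⁻¹,
          ‖∑ η ∈ directions (√K)⁻¹ with A (√r)⁻¹ η = ζ, g n η x‖ₑ ^ 2) ^ 2) Filter.atTop := by
        refine lintegral_liminf_le fun n => Measurable.pow_const ?_ 2
        refine Finset.measurable_fun_sum _ fun ζ _ => Measurable.pow_const ?_ 2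
        exact (continuous_finsetSum _ fun η _ => (g n η).continuous).enorm.measurable
    _ ≤ _ := Filter.liminf_le_of_frequently_le' (Filter.Frequently.of_forall hbound)

theorem ballSum_le_boxSum {M : ℕ} {K r : ℝ} (hK : 10 ≤ K) (hr : 1 ≤ r) (hrK : r ≤ K)
    {f : E3 → ℂ} {F : ℝ → E3 → ℂ} {A : ℝ → ℝ → ℝ} {V : Set E3} {T : ℝ → ℝ → Set E3}
    (hF : IsDecomposition K K f F) (hA : IsAssignment K K A) (hV : IsBallCover M r V)
    (hT : ∀ s, (√K)⁻¹ ≤ s → s ≤ 1 → ∀ ζ ∈ directions s, IsTiling (box K s ζ) (T s ζ)) :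
    ballSum r K A F V ≤ M * ((62 ^ 2 : ℕ) *
      (37 * (216 * ENNReal.ofReal ((1 / 10000) ^ 3 / 16)⁻¹ ^ 2))) * boxSum K A F T := by
  have hcont : ∀ η ∈ directions (√K)⁻¹, Continuous (F η) := fun η hη =>
    (hF.support_piece η hη).choose.1.continuous
  refine (hV.tsum_le ?_).trans ?_
  · refine Finset.measurable_fun_sum _ fun ζ _ => Measurable.pow_const ?_ 2
    exact (continuous_finsetSum _ fun η hη =>
      hcont η (Finset.filter_subset _ _ hη)).enorm.measurable
  · grw [lintegral_sq_sectorPiece_le_boxSum hK hr hrK hF hA hT]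
    simp only [mul_assoc, le_refl]

end ConeSquareFunction

theorem lemma3p2 (M : ℕ) (δ : ℝ) (hδ : 0 < δ) :
    ∃ C : ℝ, ∀ K r : ℝ, 10 ≤ K → 1 ≤ r → r ≤ K →
      ConeSquareFunction.SK M K r K ≤ ENNReal.ofReal (C * K ^ δ) := by
  set c : ℝ≥0∞ := M * ((62 ^ 2 : ℕ) *
    (37 * (216 * ENNReal.ofReal ((1 / 10000) ^ 3 / 16)⁻¹ ^ 2))) with hc
  have hct : c ≠ ⊤ := by
    rw [hc]
    finiteness
  refine ⟨c.toReal, fun K r hK hr hrK => ?_⟩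
  -- The constant `c` is already independent of `K`, `r` and `δ`; the factor `K ^ δ ≥ 1` only
  -- weakens the bound.
  have h1 : c ≤ ENNReal.ofReal (c.toReal * K ^ δ) := by
    conv_lhs => rw [← ENNReal.ofReal_toReal hct]
    refine ENNReal.ofReal_le_ofReal (le_mul_of_one_le_right ENNReal.toReal_nonneg ?_)
    exact Real.one_le_rpow (by linarith) hδ.le
  refine sInf_le fun f F A V T hF hA hV hT => ?_
  refine (ConeSquareFunction.ballSum_le_boxSum hK hr hrK hF hA hV hT).trans ?_
  rw [← hc]
  exact mul_le_mul_left h1 _
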